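/- All algebras are over $\mathbb{Q}$. A CDGA is a commutative (in the graded sense) cochain algebra $A=\bigoplus_{k\ge 0}A^k$ with a differential of degree $+1$; morphisms are unital algebra morphisms that preserve degrees and commute with the differentials. A digraph $\mathcal{G}$ consists of a vertex set $V(\mathcal{G})$ (possibly infinite) and a set of edges $E(\mathcal{G})\subseteq V(\mathcal{G})\times V(\mathcal{G})$ (loops are permitted). The objects of $\operatorname{sDig}$ are the strongly connected digraphs with more than one vertex. For an integer $n\ge 1$ and $\mathcal{G}$ in $\operatorname{sDig}$, let $$\mathcal{M}_n(\mathcal{G})=\Big(\Lambda(x_1,x_2,y_1,y_2,y_3,z)\otimes\Lambda\big(x_v,z_{(v,w)}\mid v\in V(\mathcal{G}),\,(v,w)\in E(\mathcal{G})\big),\,d\Big)$$ be the free graded commutative algebra on generators of degrees $|x_1|=30n+18$, $|x_2|=36n+22$, $|y_1|=126n+75$, $|y_2|=132n+79$, $|y_3|=138n+83$, $|x_v|=180n^2+218n+66$, $|z|=|z_{(v,w)}|=540n^2+654n+197$, with differential given by $dx_1=dx_2=dx_v=0$, $dy_1=x_1^3x_2$, $dy_2=x_1^2x_2^2$, $dy_3=x_1x_2^3$,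 $$dz=x_1^{18n}\big(x_2^2y_1y_2-x_1x_2y_1y_3+x_1^2y_2y_3\big)+x_1^{18n+11}+x_2^{15n+9},\qquad dz_{(v,w)}=x_v^3+x_vx_wx_2^{5n+3}+x_1^{18n+11}.$$ Two morphisms $f,g\colon A\to B$ of CDGAs are called homotopic if there is a morphism of CDGAs $\Phi\colon A\to B\otimes\Lambda(t,dt)$, with $|t|=0$ and $d(t)=dt$, such that $(\mathrm{id}\cdot\varepsilon_0)\Phi=f$ and $(\mathrm{id}\cdot\varepsilon_1)\Phi=g$, where $\varepsilon_i(t)=i$ and $\varepsilon_i(dt)=0$; $[A,B]$ denotes the set of homotopy classes, that is, the quotient of $\operatorname{Hom}_{\operatorname{CDGA}}(A,B)$ by the equivalence relation generated by homotopy. **Statement.** Let $n\ge 1$ and let $\mathcal{G}_1,\mathcal{G}_2$ be objects of $\operatorname{sDig}$. Then two morphisms $\mathcal{M}_n(\mathcal{G}_1)\to\mathcal{M}_n(\mathcal{G}_2)$ of CDGAs are homotopic if and only if they are equal. Hence $\operatorname{Hom}_{\operatorname{CDGA}}\big(\mathcal{M}_n(\mathcal{G}_1),\mathcal{M}_n(\mathcal{G}_2)\big)=[\mathcal{M}_n(\mathcal{G}_1),\mathcal{M}_n(\mathcal{G}_2)]$,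 i.e. the map sending a morphism to its homotopy class is a bijection. -/

import Mathlib

open scoped TensorProduct DirectSum

universe u v

noncomputable section

/-! ### Commutative differential graded algebras over `ℚ` -/

/-- A commutative cochain algebra `A = ⨁_{k ≥ 0} A^k` over `ℚ`: an associative unital graded
algebra, commutative in the graded sense, with a differential `d` of degree `+1` that is a graded
derivation. -/
structure CDGA where
  carrier : Type u
  [ring : Ring carrier]
  [algebra : Algebra ℚ carrier]
  grading : ℕ → Submodule ℚ carrier
  [gradedAlgebra : GradedAlgebra grading]
  d : carrier →ₗ[ℚ] carrier
  d_mem : ∀ {i : ℕ} {a : carrier}, a ∈ grading i → d a ∈ grading (i + 1)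
  d_d : ∀ a : carrier, d (d a) = 0
  leibniz : ∀ {i : ℕ} {a : carrier} (b : carrier), a ∈ grading i →
    d (a * b) = d a * b + (-1 : ℚ) ^ i • (a * d b)
  graded_comm : ∀ {i j : ℕ} {a b : carrier}, a ∈ grading i → b ∈ grading j →
    a * b = (-1 : ℚ) ^ (i * j) • (b * a)

namespace CDGA

instance : CoeSort CDGA.{u} (Type u) := ⟨CDGA.carrier⟩

instance (A : CDGA.{u}) : Ring A := A.ring

instance (A : CDGA.{u}) : Algebra ℚ A := A.algebra

instance (A : CDGA.{u}) : GradedAlgebra A.grading := A.gradedAlgebra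

/-- A morphism of CDGAs: a unital algebra morphism that preserves degrees and commutes with the
differentials. -/
structure Hom (A : CDGA.{u}) (B : CDGA.{v}) extends A.carrier →ₐ[ℚ] B.carrier where
  map_mem : ∀ {i : ℕ} {a : A}, a ∈ A.grading i → toFun a ∈ B.grading i
  map_d : ∀ a : A, toFun (A.d a) = B.d (toFun a)

/-! ### Free graded commutative algebras -/

section Free

variable {X : Type u} (deg : X → ℕ)

/-- The relations `x y = (-1)^(|x| |y|) y x` between generators. For `x = y` of odd degree this
gives `x ^ 2 = 0`, since `2` is invertible. -/
inductive FreeRel : FreeAlgebra ℚ X → FreeAlgebra ℚ X → Prop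
  | swap (x y : X) : FreeRel (FreeAlgebra.ι ℚ x * FreeAlgebra.ι ℚ y)
      ((-1 : ℚ) ^ (deg x * deg y) • (FreeAlgebra.ι ℚ y * FreeAlgebra.ι ℚ x))

/-- `Λ V`: the free graded commutative `ℚ`-algebra on the graded vector space `V` with basis `X`,
where `x : X` has degree `deg x`, as the quotient of the tensor algebra of `V`. -/
def FreeGC : Type u := RingQuot (FreeRel deg)

namespace FreeGC

instance : Ring (FreeGC deg) := inferInstanceAs (Ring (RingQuot (FreeRel deg)))

instance : Algebra ℚ (FreeGC deg) := inferInstanceAs (Algebra ℚ (RingQuot (FreeRel deg)))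

/-- The generator of `Λ V` given by `x : X`. -/
def gen (x : X) : FreeGC deg := RingQuot.mkAlgHom ℚ (FreeRel deg) (FreeAlgebra.ι ℚ x)

theorem gen_swap (x y : X) :
    gen deg x * gen deg y = (-1 : ℚ) ^ (deg x * deg y) • (gen deg y * gen deg x) := by
  have h := RingQuot.mkAlgHom_rel ℚ (FreeRel.swap (deg := deg) x y)
  rw [map_mul, map_smul, map_mul] at h
  exact h

variable {deg} in
/-- The universal property of `Λ V`. -/
def lift {C : Type*} [Ring C] [Algebra ℚ C] (f : X → C)
    (hf : ∀ x y, f x * f y = (-1 : ℚ) ^ (deg x * deg y) • (f y * f x)) : FreeGC deg →ₐ[ℚ] C :=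
  RingQuot.liftAlgHom ℚ ⟨FreeAlgebra.lift ℚ f, by
    rintro _ _ ⟨x, y⟩
    simpa using hf x y⟩

theorem lift_gen {C : Type*} [Ring C] [Algebra ℚ C] (f : X → C)
    (hf : ∀ x y, f x * f y = (-1 : ℚ) ^ (deg x * deg y) • (f y * f x)) (x : X) :
    lift f hf (gen deg x) = f x := by
  unfold lift gen
  erw [RingQuot.liftAlgHom_mkAlgHom_apply]
  simp

theorem hom_ext {C : Type*} [Ring C] [Algebra ℚ C] {f g : FreeGC deg →ₐ[ℚ] C}
    (h : ∀ x, f (gen deg x) = g (gen deg x)) : f = g := by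
  refine RingQuot.ringQuot_ext' ℚ f g ?_
  exact FreeAlgebra.hom_ext (funext h)

@[elab_as_elim]
theorem induction {P : FreeGC deg → Prop} (a : FreeGC deg)
    (scalar : ∀ r : ℚ, P (algebraMap ℚ _ r)) (gen : ∀ x, P (gen deg x))
    (mul : ∀ a b, P a → P b → P (a * b)) (add : ∀ a b, P a → P b → P (a + b)) : P a := by
  obtain ⟨b, rfl⟩ := RingQuot.mkAlgHom_surjective ℚ (FreeRel deg) a
  induction b using FreeAlgebra.induction with
  | grade0 r => rw [AlgHom.commutes]; exact scalar r
  | grade1 x => exact gen x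
  | mul a b ha hb => rw [map_mul]; exact mul _ _ ha hb
  | add a b ha hb => rw [map_add]; exact add _ _ ha hb

/-- The monomial given by a word in the generators. -/
def mono (l : List X) : FreeGC deg := (l.map (gen deg)).prod

theorem mono_append (l m : List X) : mono deg (l ++ m) = mono deg l * mono deg m := by
  simp [mono]

theorem mono_cons (x : X) (m : List X) : mono deg (x :: m) = gen deg x * mono deg m := by
  simp [mono]

/-- The degree `k` part of `Λ V`, spanned by the monomials of total degree `k`. -/
def grade (k : ℕ) : Submodule ℚ (FreeGC deg) :=
  Submodule.span ℚ {a | ∃ l : List X, (l.map deg).sum = k ∧ mono deg l = a}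

theorem mono_mem (l : List X) : mono deg l ∈ grade deg (l.map deg).sum :=
  Submodule.subset_span ⟨l, rfl, rfl⟩

theorem gen_mem (x : X) : gen deg x ∈ grade deg (deg x) := by
  simpa [mono] using mono_mem deg [x]

instance : SetLike.GradedMonoid (grade deg) where
  one_mem := by simpa [mono] using mono_mem deg []
  mul_mem := by
    intro i j a b ha hb
    refine Submodule.span_induction₂ (p := fun a b _ _ => a * b ∈ grade deg (i + j))
      ?_ ?_ ?_ ?_ ?_ ?_ ?_ ha hb
    · rintro _ _ ⟨l, rfl, rfl⟩ ⟨m, rfl, rfl⟩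
      rw [← mono_append]
      simpa using mono_mem deg (l ++ m)
    · intros; simp
    · intros; simp
    · intro x y z _ _ _ h h'; rw [add_mul]; exact add_mem h h'
    · intro x y z _ _ _ h h'; rw [mul_add]; exact add_mem h h'
    · intro r x y _ _ h; rw [smul_mul_assoc]; exact Submodule.smul_mem _ _ h
    · intro r x y _ _ h; rw [mul_smul_comm]; exact Submodule.smul_mem _ _ h

/-- The decomposition of `Λ V` into its homogeneous parts, determined on generators. -/
def decomp : FreeGC deg →ₐ[ℚ] ⨁ k, grade deg k :=
  lift (fun x => DirectSum.of (fun k => grade deg k) (deg x) ⟨gen deg x, gen_mem deg x⟩) (by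
    intro x y
    rw [DirectSum.of_mul_of, DirectSum.of_mul_of, ← DirectSum.lof_eq_of ℚ,
      ← DirectSum.lof_eq_of ℚ, ← map_smul, DirectSum.lof_eq_of, DirectSum.lof_eq_of]
    apply DirectSum.of_eq_of_gradedMonoid_eq
    refine Sigma.subtype_ext (add_comm _ _) ?_
    exact gen_swap deg x y)

theorem decomp_mono (l : List X) :
    decomp deg (mono deg l)
      = DirectSum.of (fun k => grade deg k) (l.map deg).sum ⟨mono deg l, mono_mem deg l⟩ := by
  induction l with
  | nil => simp only [mono, List.map_nil, List.prod_nil, map_one]; rfl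
  | cons x l ih =>
    have h : decomp deg (mono deg (x :: l)) = decomp deg (gen deg x) * decomp deg (mono deg l) := by
      rw [mono_cons, map_mul]
    rw [h, ih, decomp, lift_gen, DirectSum.of_mul_of]
    apply DirectSum.of_eq_of_gradedMonoid_eq
    refine Sigma.subtype_ext (show deg x + (l.map deg).sum = ((x :: l).map deg).sum by
      rw [List.map_cons, List.sum_cons]) ?_
    exact (mono_cons deg x l).symm

instance : GradedAlgebra (grade deg) :=
  GradedAlgebra.ofAlgHom _ (decomp deg)
    (by
      refine hom_ext deg fun x => ?_
      simp [decomp, lift_gen])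
    (by
      rintro k ⟨a, ha⟩
      change decomp deg a = _
      refine Submodule.span_induction
        (p := fun a ha => decomp deg a = DirectSum.of (fun k => grade deg k) k ⟨a, ha⟩)
        ?_ ?_ ?_ ?_ ha
      · rintro _ ⟨l, rfl, rfl⟩
        exact decomp_mono deg l
      · rw [map_zero]; exact (map_zero (DirectSum.of (fun k => grade deg k) k)).symm
      · intro x y hx hy h h'
        rw [map_add, h, h', ← map_add]; rfl
      · intro r x hx h
        rw [map_smul, h, ← DirectSum.lof_eq_of ℚ, ← map_smul]; rfl)

theorem gen_mul_mono (x : X) (l : List X) :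
    gen deg x * mono deg l = (-1 : ℚ) ^ (deg x * (l.map deg).sum) • (mono deg l * gen deg x) := by
  induction l with
  | nil => simp [mono]
  | cons y l ih =>
    rw [mono_cons, ← mul_assoc, gen_swap, smul_mul_assoc, mul_assoc, ih, mul_smul_comm, smul_smul,
      mul_assoc, List.map_cons, List.sum_cons, mul_add, pow_add]

theorem mono_mul_mono (l m : List X) : mono deg l * mono deg m
    = (-1 : ℚ) ^ ((l.map deg).sum * (m.map deg).sum) • (mono deg m * mono deg l) := by
  induction l with
  | nil => simp [mono]
  | cons x l ih =>
    rw [mono_cons, mul_assoc, ih, mul_smul_comm, ← mul_assoc, gen_mul_mono, smul_mul_assoc,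
      smul_smul, mul_assoc, List.map_cons, List.sum_cons, add_mul, pow_add, mul_comm]

theorem graded_comm {i j : ℕ} {a b : FreeGC deg} (ha : a ∈ grade deg i) (hb : b ∈ grade deg j) :
    a * b = (-1 : ℚ) ^ (i * j) • (b * a) := by
  refine Submodule.span_induction₂
    (p := fun a b _ _ => a * b = (-1 : ℚ) ^ (i * j) • (b * a)) ?_ ?_ ?_ ?_ ?_ ?_ ?_ ha hb
  · rintro _ _ ⟨l, rfl, rfl⟩ ⟨m, rfl, rfl⟩
    exact mono_mul_mono deg l m
  · intros; simp
  · intros; simp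
  · intro x y z _ _ _ h h'; rw [add_mul, mul_add, smul_add, h, h']
  · intro x y z _ _ _ h h'; rw [add_mul, mul_add, smul_add, h, h']
  · intro r x y _ _ h; rw [smul_mul_assoc, mul_smul_comm, h, smul_comm]
  · intro r x y _ _ h; rw [smul_mul_assoc, mul_smul_comm, h, smul_comm]

/-- The involution `a ↦ (-1)^|a| a`. -/
def sgn : FreeGC deg →ₐ[ℚ] FreeGC deg :=
  lift (fun x => (-1 : ℚ) ^ deg x • gen deg x) (by
    intro x y
    simp only [smul_mul_smul_comm]
    rw [gen_swap deg x y, smul_smul, smul_smul]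
    congr 1
    ring)

theorem sgn_gen (x : X) : sgn deg (gen deg x) = (-1 : ℚ) ^ deg x • gen deg x := lift_gen _ _ _ _

theorem sgn_of_mem {i : ℕ} {a : FreeGC deg} (ha : a ∈ grade deg i) :
    sgn deg a = (-1 : ℚ) ^ i • a := by
  refine Submodule.span_induction (p := fun a _ => sgn deg a = (-1 : ℚ) ^ i • a) ?_ ?_ ?_ ?_ ha
  · rintro _ ⟨l, rfl, rfl⟩
    clear ha
    induction l with
    | nil => simp [mono]
    | cons x l ih =>
      rw [mono_cons, map_mul, ih, sgn_gen, smul_mul_smul_comm]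
      simp [pow_add]
  · simp
  · intro x y _ _ h h'; rw [map_add, h, h', smul_add]
  · intro r x _ h; rw [map_smul, h, smul_comm]

theorem sgn_sgn (a : FreeGC deg) : sgn deg (sgn deg a) = a := by
  have : (sgn deg).comp (sgn deg) = AlgHom.id ℚ _ := by
    refine hom_ext deg fun x => ?_
    simp only [AlgHom.comp_apply, sgn_gen, map_smul, smul_smul, AlgHom.id_apply]
    rw [← mul_pow]
    simp
  exact DFunLike.congr_fun this a

variable (D : X → FreeGC deg) (hD : ∀ x, D x ∈ grade deg (deg x + 1))

/-- The algebra morphism `a ↦ !![(-1)^|a| a, d a; 0, a]`: it is multiplicative exactly because `d`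
is a graded derivation, so it is determined by the values `d x = D x` on generators. -/
def toMat : FreeGC deg →ₐ[ℚ] Matrix (Fin 2) (Fin 2) (FreeGC deg) :=
  lift (fun x => !![(-1 : ℚ) ^ deg x • gen deg x, D x; 0, gen deg x]) (by
    intro x y
    have h1 := graded_comm deg (gen_mem deg x) (hD y)
    have h2 := graded_comm deg (hD x) (gen_mem deg y)
    have h3 := gen_swap deg x y
    have key : (-1 : ℚ) ^ deg x • (gen deg x * D y) + D x * gen deg y
        = (-1 : ℚ) ^ (deg x * deg y) • ((-1 : ℚ) ^ deg y • (gen deg y * D x)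
          + D y * gen deg x) := by
      rw [h1, h2, smul_smul, smul_add, smul_smul, add_comm]
      congr 2
      · ring
      · rw [← pow_add, show deg x + deg x * (deg y + 1) = deg x * deg y + 2 * deg x by ring,
          pow_add, pow_mul]
        simp
    ext i j
    fin_cases i <;> fin_cases j
    · simp [Matrix.mul_apply, h3, smul_smul]
      congr 1
      ring
    · simpa [Matrix.mul_apply] using key
    · simp [Matrix.mul_apply]
    · simpa [Matrix.mul_apply] using h3)

theorem toMat_gen (x : X) : toMat deg D hD (gen deg x)
    = !![(-1 : ℚ) ^ deg x • gen deg x, D x; 0, gen deg x] := lift_gen _ _ _ _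

theorem toMat_entries (a : FreeGC deg) : toMat deg D hD a 0 0 = sgn deg a ∧
    toMat deg D hD a 1 0 = 0 ∧ toMat deg D hD a 1 1 = a := by
  induction a using induction with
  | scalar r => simp [Matrix.algebraMap_matrix_apply]
  | gen x => simp [toMat_gen, sgn_gen]
  | mul a b ha hb =>
    obtain ⟨h1, h2, h3⟩ := ha
    obtain ⟨k1, k2, k3⟩ := hb
    simp [Matrix.mul_apply, h1, h2, h3, k1, k2, k3]
  | add a b ha hb =>
    obtain ⟨h1, h2, h3⟩ := ha
    obtain ⟨k1, k2, k3⟩ := hb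
    simp [h1, h2, h3, k1, k2, k3]

/-- The unique graded derivation of degree `+1` of `Λ V` with `d x = D x` on generators. -/
def diff : FreeGC deg →ₗ[ℚ] FreeGC deg where
  toFun a := toMat deg D hD a 0 1
  map_add' a b := by simp
  map_smul' r a := by simp

theorem diff_gen (x : X) : diff deg D hD (gen deg x) = D x := by
  change toMat deg D hD (gen deg x) 0 1 = _
  simp [toMat_gen]

theorem diff_algebraMap (r : ℚ) : diff deg D hD (algebraMap ℚ _ r) = 0 := by
  change toMat deg D hD (algebraMap ℚ _ r) 0 1 = _
  simp [Matrix.algebraMap_matrix_apply]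

theorem diff_mul (a b : FreeGC deg) :
    diff deg D hD (a * b) = diff deg D hD a * b + sgn deg a * diff deg D hD b := by
  change toMat deg D hD (a * b) 0 1
    = toMat deg D hD a 0 1 * b + sgn deg a * toMat deg D hD b 0 1
  rw [map_mul, Matrix.mul_apply, Fin.sum_univ_two, (toMat_entries deg D hD a).1,
    (toMat_entries deg D hD b).2.2, add_comm]

theorem diff_mem {i : ℕ} {a : FreeGC deg} (ha : a ∈ grade deg i) :
    diff deg D hD a ∈ grade deg (i + 1) := by
  refine Submodule.span_induction (p := fun a _ => diff deg D hD a ∈ grade deg (i + 1))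
    ?_ ?_ ?_ ?_ ha
  · rintro _ ⟨l, rfl, rfl⟩
    clear ha
    induction l with
    | nil =>
      have : mono deg ([] : List X) = algebraMap ℚ _ 1 := by simp [mono]
      rw [this, diff_algebraMap]
      exact zero_mem _
    | cons x l ih =>
      rw [mono_cons, diff_mul, diff_gen, sgn_gen, smul_mul_assoc, List.map_cons, List.sum_cons]
      refine add_mem ?_ (Submodule.smul_mem _ _ ?_)
      · rw [add_right_comm]
        exact SetLike.mul_mem_graded (hD x) (mono_mem deg l)
      · rw [add_assoc]
        exact SetLike.mul_mem_graded (gen_mem deg x) ih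
  · simp
  · intro x y _ _ h h'; rw [map_add]; exact add_mem h h'
  · intro r x _ h; rw [map_smul]; exact Submodule.smul_mem _ _ h

theorem sgn_diff (a : FreeGC deg) :
    sgn deg (diff deg D hD a) = - diff deg D hD (sgn deg a) := by
  induction a using induction with
  | scalar r => simp [diff_algebraMap]
  | gen x =>
    rw [diff_gen, sgn_gen, map_smul, diff_gen, sgn_of_mem deg (hD x), pow_succ]
    simp
  | mul a b ha hb =>
    rw [diff_mul, map_add, map_mul, map_mul, map_mul, diff_mul, ha, hb]
    simp only [neg_mul, mul_neg, neg_add]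
  | add a b ha hb => rw [map_add, map_add, ha, hb, map_add, map_add, neg_add]

theorem diff_diff (hDD : ∀ x, diff deg D hD (D x) = 0) (a : FreeGC deg) :
    diff deg D hD (diff deg D hD a) = 0 := by
  induction a using induction with
  | scalar r => simp [diff_algebraMap]
  | gen x => rw [diff_gen, hDD]
  | mul a b ha hb =>
    rw [diff_mul, map_add, diff_mul, diff_mul, ha, hb, sgn_diff]
    simp
  | add a b ha hb => rw [map_add, map_add, ha, hb, add_zero]

/-- The CDGA `(Λ V, d)` with `d x = D x` on the generators `x`, provided that `D x` has degree
`|x| + 1` and `d (D x) = 0` for every generator. -/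
def cdga (hDD : ∀ x, diff deg D hD (D x) = 0) : CDGA.{u} where
  carrier := FreeGC deg
  grading := grade deg
  d := diff deg D hD
  d_mem := diff_mem deg D hD
  d_d := diff_diff deg D hD hDD
  leibniz b ha := by rw [diff_mul, sgn_of_mem deg ha, smul_mul_assoc]
  graded_comm := graded_comm deg

end FreeGC

end Free

/-! ### Tensor products of CDGAs -/

section Tensor

/-- The involution `a ↦ (-1)^|a| a`. -/
def sgn (A : CDGA.{u}) : A →ₗ[ℚ] A :=
  (DirectSum.toModule ℚ ℕ A fun i => (-1 : ℚ) ^ i • (A.grading i).subtype) ∘ₗ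
    (DirectSum.decomposeLinearEquiv A.grading).toLinearMap

theorem sgn_of_mem (A : CDGA.{u}) {i : ℕ} {a : A} (ha : a ∈ A.grading i) :
    A.sgn a = (-1 : ℚ) ^ i • a := by
  lift a to A.grading i using ha
  simp only [sgn, LinearMap.comp_apply, LinearEquiv.coe_coe, DirectSum.decomposeLinearEquiv_apply,
    DirectSum.decompose_coe, ← DirectSum.lof_eq_of ℚ, DirectSum.toModule_lof]
  rfl

variable (A : CDGA.{u}) (B : CDGA.{v})

/-- The graded algebra `A ⊗ B`, with `(a ⊗ b) (a' ⊗ b') = (-1)^(|b| |a'|) a a' ⊗ b b'`. -/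
abbrev TensorCarrier : Type (max u v) := A.grading ᵍ⊗[ℚ] B.grading

/-- The pure tensor `a ⊗ b`. -/
def tm (a : A) (b : B) : TensorCarrier A B := GradedTensorProduct.tmul ℚ a b

theorem tm_mul {j i' : ℕ} (a : A) {b : B} {a' : A} (b' : B) (hb : b ∈ B.grading j)
    (ha' : a' ∈ A.grading i') :
    tm A B a b * tm A B a' b' = (-1 : ℚ) ^ (j * i') • tm A B (a * a') (b * b') := by
  have h := GradedTensorProduct.tmul_coe_mul_coe_tmul (R := ℚ) A.grading B.grading a
    (⟨b, hb⟩ : B.grading j) (⟨a', ha'⟩ : A.grading i') b'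
  refine h.trans ?_
  rw [Units.smul_def, ← Int.cast_smul_eq_zsmul ℚ]
  simp [tm]

theorem tm_smul_left (r : ℚ) (a : A) (b : B) : tm A B (r • a) b = r • tm A B a b := rfl

theorem tm_smul_right (r : ℚ) (a : A) (b : B) : tm A B a (r • b) = r • tm A B a b := by
  exact (congrArg (GradedTensorProduct.of ℚ A.grading B.grading)
    (TensorProduct.tmul_smul r a b)).trans (map_smul _ _ _)

theorem tm_zero_left (b : B) : tm A B 0 b = 0 := by
  exact (congrArg (GradedTensorProduct.of ℚ A.grading B.grading)
    (TensorProduct.zero_tmul _ b)).trans (map_zero _)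

theorem tm_zero_right (a : A) : tm A B a 0 = 0 := by
  exact (congrArg (GradedTensorProduct.of ℚ A.grading B.grading)
    (TensorProduct.tmul_zero _ a)).trans (map_zero _)

theorem tm_add_left (a a' : A) (b : B) : tm A B (a + a') b = tm A B a b + tm A B a' b := by
  exact (congrArg (GradedTensorProduct.of ℚ A.grading B.grading)
    (TensorProduct.add_tmul a a' b)).trans (map_add _ _ _)

theorem tm_add_right (a : A) (b b' : B) : tm A B a (b + b') = tm A B a b + tm A B a b' := by
  exact (congrArg (GradedTensorProduct.of ℚ A.grading B.grading)
    (TensorProduct.tmul_add a b b')).trans (map_add _ _ _)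

/-- The degree `k` part `⨁_{i + j = k} A^i ⊗ B^j` of `A ⊗ B`. -/
def tensorGrading (k : ℕ) : Submodule ℚ (TensorCarrier A B) :=
  Submodule.span ℚ
    {x | ∃ i j : ℕ, i + j = k ∧ ∃ a ∈ A.grading i, ∃ b ∈ B.grading j, tm A B a b = x}

theorem tm_mem {i j : ℕ} {a : A} {b : B} (ha : a ∈ A.grading i) (hb : b ∈ B.grading j) :
    tm A B a b ∈ tensorGrading A B (i + j) :=
  Submodule.subset_span ⟨i, j, rfl, a, ha, b, hb, rfl⟩

instance : SetLike.GradedMonoid (tensorGrading A B) where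
  one_mem := by
    have h : tm A B 1 1 ∈ tensorGrading A B (0 + 0) :=
      tm_mem A B (SetLike.one_mem_graded A.grading) (SetLike.one_mem_graded B.grading)
    exact h
  mul_mem := by
    intro k l x y hx hy
    refine Submodule.span_induction₂ (p := fun x y _ _ => x * y ∈ tensorGrading A B (k + l))
      ?_ ?_ ?_ ?_ ?_ ?_ ?_ hx hy
    · rintro _ _ ⟨i, j, rfl, a, ha, b, hb, rfl⟩ ⟨i', j', rfl, a', ha', b', hb', rfl⟩
      rw [tm_mul A B a b' hb ha', show i + j + (i' + j') = i + i' + (j + j') by ring]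
      exact Submodule.smul_mem _ _
        (tm_mem A B (SetLike.mul_mem_graded ha ha') (SetLike.mul_mem_graded hb hb'))
    · intros; simp
    · intros; simp
    · intro x y z _ _ _ h h'; rw [add_mul]; exact add_mem h h'
    · intro x y z _ _ _ h h'; rw [mul_add]; exact add_mem h h'
    · intro r x y _ _ h; rw [smul_mul_assoc]; exact Submodule.smul_mem _ _ h
    · intro r x y _ _ h; rw [mul_smul_comm]; exact Submodule.smul_mem _ _ h

@[elab_as_elim]
theorem tensor_induction {P : TensorCarrier A B → Prop} (x : TensorCarrier A B) (zero : P 0)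
    (tm : ∀ (i j : ℕ) (a : A) (b : B), a ∈ A.grading i → b ∈ B.grading j → P (tm A B a b))
    (add : ∀ x y, P x → P y → P (x + y)) : P x := by
  induction x using TensorProduct.induction_on with
  | zero => exact zero
  | add x y hx hy => exact add x y hx hy
  | tmul a b =>
    change P (CDGA.tm A B a b)
    induction a using DirectSum.Decomposition.inductionOn A.grading with
    | zero =>
      rw [tm_zero_left]; exact zero
    | add a a' h h' => rw [tm_add_left]; exact add _ _ h h'
    | homogeneous a =>
      induction b using DirectSum.Decomposition.inductionOn B.grading with
      | zero =>
        rw [tm_zero_right]; exact zero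
      | add b b' h h' => rw [tm_add_right]; exact add _ _ h h'
      | homogeneous b => exact tm _ _ _ _ a.2 b.2

/-- The decomposition of `A ⊗ B` into its homogeneous parts. -/
def tensorDecomp : TensorCarrier A B →ₗ[ℚ] ⨁ k, tensorGrading A B k :=
  TensorProduct.lift
    ((DirectSum.toModule ℚ ℕ _ fun i => LinearMap.flip
      (DirectSum.toModule ℚ ℕ _ fun j => LinearMap.flip
        (LinearMap.mk₂ ℚ
          (fun (a : A.grading i) (b : B.grading j) =>
            DirectSum.lof ℚ ℕ (fun k => tensorGrading A B k) (i + j)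
              ⟨tm A B a b, tm_mem A B a.2 b.2⟩)
          (fun a a' b => by rw [← map_add]; congr 1; exact Subtype.ext (tm_add_left A B a a' b))
          (fun r a b => by rw [← map_smul]; rfl)
          (fun a b b' => by rw [← map_add]; congr 1; exact Subtype.ext (tm_add_right A B a b b'))
          (fun r a b => by
            rw [← map_smul]; congr 1; exact Subtype.ext (tm_smul_right A B r a b))))).compl₁₂
      (DirectSum.decomposeLinearEquiv A.grading).toLinearMap
      (DirectSum.decomposeLinearEquiv B.grading).toLinearMap) ∘ₗ
    (GradedTensorProduct.of ℚ A.grading B.grading).symm.toLinearMap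

theorem tensorDecomp_tm {i j : ℕ} {a : A} {b : B} (ha : a ∈ A.grading i)
    (hb : b ∈ B.grading j) : tensorDecomp A B (tm A B a b)
      = DirectSum.lof ℚ ℕ (fun k => tensorGrading A B k) (i + j)
          ⟨tm A B a b, tm_mem A B ha hb⟩ := by
  lift a to A.grading i using ha
  lift b to B.grading j using hb
  change TensorProduct.lift _ ((a : A) ⊗ₜ[ℚ] (b : B)) = _
  simp only [LinearEquiv.coe_coe, TensorProduct.lift.tmul, LinearMap.compl₁₂_apply,
    DirectSum.decomposeLinearEquiv_apply, DirectSum.decompose_coe, ← DirectSum.lof_eq_of ℚ,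
    DirectSum.toModule_lof, LinearMap.flip_apply, LinearMap.mk₂_apply]

instance : GradedAlgebra (tensorGrading A B) where
  toDecomposition := DirectSum.Decomposition.ofLinearMap _ (tensorDecomp A B)
    (by
      refine LinearMap.ext fun x => ?_
      induction x using tensor_induction with
      | zero => simp
      | add x y h h' => rw [map_add, h, h', map_add]
      | tm i j a b ha hb =>
        rw [LinearMap.comp_apply, tensorDecomp_tm A B ha hb, DirectSum.coeLinearMap_lof]
        rfl)
    (by
      refine DirectSum.linearMap_ext _ fun k => LinearMap.ext ?_
      rintro ⟨x, hx⟩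
      change tensorDecomp A B (DirectSum.coeLinearMap (tensorGrading A B)
        (DirectSum.lof ℚ ℕ (fun k => tensorGrading A B k) k ⟨x, hx⟩)) = _
      rw [DirectSum.coeLinearMap_lof]
      change tensorDecomp A B x = DirectSum.lof ℚ ℕ (fun k => tensorGrading A B k) k ⟨x, hx⟩
      refine Submodule.span_induction (p := fun x hx => tensorDecomp A B x
        = DirectSum.lof ℚ ℕ (fun k => tensorGrading A B k) k ⟨x, hx⟩) ?_ ?_ ?_ ?_ hx
      · rintro _ ⟨i, j, rfl, a, ha, b, hb, rfl⟩
        exact tensorDecomp_tm A B ha hb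
      · rw [map_zero]
        exact (map_zero (DirectSum.lof ℚ ℕ (fun k => tensorGrading A B k) k)).symm
      · intro x y hx hy h h'
        rw [map_add, h, h', ← map_add]; rfl
      · intro r x hx h
        rw [map_smul, h, ← map_smul]; rfl)

/-- The differential `d (a ⊗ b) = d a ⊗ b + (-1)^|a| a ⊗ d b`. -/
def tensorDiff : TensorCarrier A B →ₗ[ℚ] TensorCarrier A B :=
  (GradedTensorProduct.of ℚ A.grading B.grading).toLinearMap ∘ₗ
    (TensorProduct.map A.d LinearMap.id + TensorProduct.map A.sgn B.d) ∘ₗ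
    (GradedTensorProduct.of ℚ A.grading B.grading).symm.toLinearMap

theorem tensorDiff_tm {i : ℕ} {a : A} (b : B) (ha : a ∈ A.grading i) :
    tensorDiff A B (tm A B a b) = tm A B (A.d a) b + (-1 : ℚ) ^ i • tm A B a (B.d b) := by
  rw [← tm_smul_left, ← sgn_of_mem A ha]
  rfl

theorem tensorDiff_mem {k : ℕ} {x : TensorCarrier A B} (hx : x ∈ tensorGrading A B k) :
    tensorDiff A B x ∈ tensorGrading A B (k + 1) := by
  refine Submodule.span_induction (p := fun x _ => tensorDiff A B x ∈ tensorGrading A B (k + 1))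
    ?_ ?_ ?_ ?_ hx
  · rintro _ ⟨i, j, rfl, a, ha, b, hb, rfl⟩
    rw [tensorDiff_tm A B b ha]
    refine add_mem ?_ (Submodule.smul_mem _ _ ?_)
    · rw [add_right_comm]; exact tm_mem A B (A.d_mem ha) hb
    · rw [add_assoc]; exact tm_mem A B ha (B.d_mem hb)
  · simp
  · intro x y _ _ h h'; rw [map_add]; exact add_mem h h'
  · intro r x _ h; rw [map_smul]; exact Submodule.smul_mem _ _ h

theorem tensorDiff_tensorDiff (x : TensorCarrier A B) : tensorDiff A B (tensorDiff A B x) = 0 := by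
  induction x using tensor_induction with
  | zero => simp
  | add x y h h' => rw [map_add, map_add, h, h', add_zero]
  | tm i j a b ha hb =>
    rw [tensorDiff_tm A B b ha, map_add, map_smul, tensorDiff_tm A B b (A.d_mem ha),
      tensorDiff_tm A B (B.d b) ha, A.d_d, B.d_d]
    simp [tm_zero_left, tm_zero_right, pow_succ]

theorem tensor_leibniz {k : ℕ} {x : TensorCarrier A B} (y : TensorCarrier A B)
    (hx : x ∈ tensorGrading A B k) : tensorDiff A B (x * y)
      = tensorDiff A B x * y + (-1 : ℚ) ^ k • (x * tensorDiff A B y) := by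
  refine Submodule.span_induction (p := fun x _ => tensorDiff A B (x * y)
      = tensorDiff A B x * y + (-1 : ℚ) ^ k • (x * tensorDiff A B y)) ?_ ?_ ?_ ?_ hx
  · rintro _ ⟨i, j, rfl, a, ha, b, hb, rfl⟩
    induction y using tensor_induction with
    | zero => simp
    | add y y' h h' =>
      rw [mul_add, map_add, h, h', map_add, mul_add, mul_add, smul_add]
      abel
    | tm i' j' a' b' ha' hb' =>
      have s : ∀ m : ℕ, (-1 : ℚ) ^ (m * 2) = 1 := fun m => by rw [mul_comm, pow_mul]; simp
      rw [tm_mul A B a b' hb ha', map_smul,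
        tensorDiff_tm A B _ (SetLike.mul_mem_graded ha ha'), A.leibniz a' ha, B.leibniz b' hb,
        tensorDiff_tm A B b ha, tensorDiff_tm A B b' ha', add_mul, mul_add,
        smul_mul_assoc, mul_smul_comm, tm_mul A B _ _ hb ha', tm_mul A B _ _ (B.d_mem hb) ha',
        tm_mul A B _ _ hb (A.d_mem ha'), tm_mul A B _ _ hb ha']
      simp only [tm_add_left, tm_add_right, tm_smul_left, tm_smul_right]
      match_scalars <;> ring_nf
      simp [s]
  · simp
  · intro x x' _ _ h h'
    rw [add_mul, map_add, h, h', map_add, add_mul, add_mul, smul_add]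
    abel
  · intro r x _ h
    rw [smul_mul_assoc, map_smul, h, map_smul, smul_mul_assoc, smul_mul_assoc, smul_add, smul_comm r]

theorem tensor_graded_comm {k l : ℕ} {x y : TensorCarrier A B} (hx : x ∈ tensorGrading A B k)
    (hy : y ∈ tensorGrading A B l) : x * y = (-1 : ℚ) ^ (k * l) • (y * x) := by
  refine Submodule.span_induction₂
    (p := fun x y _ _ => x * y = (-1 : ℚ) ^ (k * l) • (y * x)) ?_ ?_ ?_ ?_ ?_ ?_ ?_ hx hy
  · rintro _ _ ⟨i, j, rfl, a, ha, b, hb, rfl⟩ ⟨i', j', rfl, a', ha', b', hb', rfl⟩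
    rw [tm_mul A B a b' hb ha', tm_mul A B a' b hb' ha, A.graded_comm ha ha',
      B.graded_comm hb hb', tm_smul_left, tm_smul_right, smul_smul, smul_smul, smul_smul]
    congr 1
    have s : ∀ m : ℕ, (-1 : ℚ) ^ (m * 2) = 1 := fun m => by rw [mul_comm, pow_mul]; simp
    rw [← pow_add, ← pow_add, ← pow_add,
      show (i + j) * (i' + j') + j' * i = j * i' + i * i' + j * j' + (j' * i) * 2 by ring,
      pow_add _ _ ((j' * i) * 2), s, mul_one]
  · intros; simp
  · intros; simp
  · intro x y z _ _ _ h h'; rw [add_mul, mul_add, smul_add, h, h']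
  · intro x y z _ _ _ h h'; rw [add_mul, mul_add, smul_add, h, h']
  · intro r x y _ _ h; rw [smul_mul_assoc, mul_smul_comm, h, smul_comm]
  · intro r x y _ _ h; rw [smul_mul_assoc, mul_smul_comm, h, smul_comm]

/-- The tensor product `A ⊗ B` of CDGAs. -/
def tensor : CDGA.{max u v} where
  carrier := TensorCarrier A B
  grading := tensorGrading A B
  d := tensorDiff A B
  d_mem := tensorDiff_mem A B
  d_d := tensorDiff_tensorDiff A B
  leibniz := tensor_leibniz A B
  graded_comm := tensor_graded_comm A B

end Tensor

/-! ### Homotopy -/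

section Homotopy

/-- The underlying algebra `ℚ[t] ⊕ ℚ[t] dt` of `Λ(t, dt)`, with `dt ^ 2 = 0`. -/
abbrev Forms : Type := TrivSqZeroExt (Polynomial ℚ) (Polynomial ℚ)

namespace Forms

/-- The forms of degree `0` are the `p(t)`, those of degree `1` are the `q(t) dt`. -/
def grading (k : ℕ) : Submodule ℚ Forms where
  carrier := {ω | (k ≠ 0 → ω.fst = 0) ∧ (k ≠ 1 → ω.snd = 0)}
  zero_mem' := by simp
  add_mem' := by
    rintro a b ⟨h1, h2⟩ ⟨h3, h4⟩
    exact ⟨fun h => by simp [h1 h, h3 h], fun h => by simp [h2 h, h4 h]⟩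
  smul_mem' := by
    rintro r a ⟨h1, h2⟩
    exact ⟨fun h => by simp [h1 h], fun h => by simp [h2 h]⟩

theorem mem_grading {k : ℕ} {ω : Forms} :
    ω ∈ grading k ↔ (k ≠ 0 → ω.fst = 0) ∧ (k ≠ 1 → ω.snd = 0) := Iff.rfl

theorem inl_mem (p : Polynomial ℚ) : TrivSqZeroExt.inl p ∈ grading 0 := by simp [mem_grading]

theorem inr_mem (p : Polynomial ℚ) : TrivSqZeroExt.inr p ∈ grading 1 := by simp [mem_grading]

instance : SetLike.GradedMonoid grading where
  one_mem := by simp [mem_grading]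
  mul_mem := by
    rintro i j a b ⟨h1, h2⟩ ⟨h3, h4⟩
    refine ⟨fun h => ?_, fun h => ?_⟩
    · rcases Nat.eq_zero_or_pos i with rfl | hi
      · simp [h3 (by omega)]
      · simp [h1 (by omega)]
    · have e1 : a.fst • b.snd = 0 := by
        rcases Nat.eq_zero_or_pos i with rfl | hi
        · rw [h4 (by omega), smul_zero]
        · rw [h1 (by omega), zero_smul]
      have e2 : MulOpposite.op b.fst • a.snd = 0 := by
        rcases Nat.eq_zero_or_pos j with rfl | hi
        · rw [h2 (by omega), smul_zero]
        · rw [h3 (by omega), MulOpposite.op_zero, zero_smul]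
      rw [TrivSqZeroExt.snd_mul, e1, e2, add_zero]

/-- The decomposition of a form into its parts of degree `0` and `1`. -/
def decomp : Forms →ₗ[ℚ] ⨁ k, grading k :=
  DirectSum.lof ℚ ℕ (fun k => grading k) 0 ∘ₗ
      LinearMap.codRestrict (grading 0) ((TrivSqZeroExt.inlAlgHom ℚ (Polynomial ℚ) (Polynomial ℚ)).comp
        (TrivSqZeroExt.fstHom ℚ (Polynomial ℚ) (Polynomial ℚ))).toLinearMap
        (fun ω => inl_mem ω.fst)
    + DirectSum.lof ℚ ℕ (fun k => grading k) 1 ∘ₗ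
      LinearMap.codRestrict (grading 1) ((TrivSqZeroExt.inrHom (Polynomial ℚ) _ ∘ₗ
        TrivSqZeroExt.sndHom (Polynomial ℚ) (Polynomial ℚ)).restrictScalars ℚ)
        (fun ω => inr_mem ω.snd)

instance : GradedAlgebra grading where
  toDecomposition := DirectSum.Decomposition.ofLinearMap _ decomp
    (by
      refine LinearMap.ext fun ω => ?_
      rw [LinearMap.comp_apply, decomp, LinearMap.add_apply, map_add, LinearMap.comp_apply,
        LinearMap.comp_apply, DirectSum.coeLinearMap_lof, DirectSum.coeLinearMap_lof]
      exact TrivSqZeroExt.inl_fst_add_inr_snd_eq ω)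
    (by
      refine DirectSum.linearMap_ext _ fun i => LinearMap.ext ?_
      rintro ⟨ω, h1, h2⟩
      rw [LinearMap.comp_apply, LinearMap.comp_apply, DirectSum.coeLinearMap_lof]
      have z : ∀ j (x : grading j), (x : Forms) = 0 →
          DirectSum.lof ℚ ℕ (fun k => grading k) j x = 0 := by
        rintro j ⟨x, hx⟩ rfl
        exact map_zero _
      change DirectSum.lof ℚ ℕ (fun k => grading k) 0 ⟨TrivSqZeroExt.inl ω.fst, inl_mem _⟩
        + DirectSum.lof ℚ ℕ (fun k => grading k) 1 ⟨TrivSqZeroExt.inr ω.snd, inr_mem _⟩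
        = DirectSum.lof ℚ ℕ (fun k => grading k) i ⟨ω, h1, h2⟩
      have e := TrivSqZeroExt.inl_fst_add_inr_snd_eq ω
      by_cases e0 : i = 0
      · subst e0
        rw [z 1 _ (by rw [h2 (by omega)]; exact TrivSqZeroExt.inr_zero _), add_zero]
        congr 1
        apply Subtype.ext
        rw [h2 (by omega), TrivSqZeroExt.inr_zero, add_zero] at e
        exact e
      · by_cases e1 : i = 1
        · subst e1
          rw [z 0 _ (by rw [h1 (by omega)]; exact TrivSqZeroExt.inl_zero _), zero_add]
          congr 1
          apply Subtype.ext
          rw [h1 (by omega), TrivSqZeroExt.inl_zero, zero_add] at e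
          exact e
        · rw [z 1 _ (by rw [h2 e1]; exact TrivSqZeroExt.inr_zero _),
            z 0 _ (by rw [h1 e0]; exact TrivSqZeroExt.inl_zero _), z i _ ?_, add_zero]
          rw [h1 e0, h2 e1, TrivSqZeroExt.inl_zero, TrivSqZeroExt.inr_zero, add_zero] at e
          exact e.symm)

/-- `d (p(t) + q(t) dt) = p'(t) dt`. -/
def diff : Forms →ₗ[ℚ] Forms where
  toFun ω := TrivSqZeroExt.inr (Polynomial.derivative ω.fst)
  map_add' a b := by rw [TrivSqZeroExt.fst_add, map_add, TrivSqZeroExt.inr_add]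
  map_smul' r a := by
    rw [TrivSqZeroExt.fst_smul, map_smul, TrivSqZeroExt.inr_smul, RingHom.id_apply]

/-- The evaluation `p(t) + q(t) dt ↦ p(s)`. -/
def eval (s : ℚ) : Forms →ₐ[ℚ] ℚ :=
  (Polynomial.aeval s).comp (TrivSqZeroExt.fstHom ℚ (Polynomial ℚ) (Polynomial ℚ))

theorem eval_of_mem (s : ℚ) {k : ℕ} (hk : k ≠ 0) {ω : Forms} (h : ω ∈ grading k) :
    eval s ω = 0 := by
  simp [eval, h.1 hk]

end Forms

/-- The CDGA `Λ(t, dt)`, free on `t` of degree `0` and `dt` of degree `1` with `d(t) = dt`, in the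
concrete form `ℚ[t] ⊕ ℚ[t] dt`. -/
def interval : CDGA.{0} where
  carrier := Forms
  grading := Forms.grading
  d := Forms.diff
  d_mem := by
    rintro i a ⟨h1, h2⟩
    refine ⟨fun _ => by simp [Forms.diff], fun h => ?_⟩
    simp [Forms.diff, h1 (by omega)]
  d_d a := by simp [Forms.diff]
  leibniz := by
    rintro i a b ⟨h1, h2⟩
    rcases Nat.eq_zero_or_pos i with rfl | hi
    · ext <;> simp [Forms.diff, Polynomial.derivative_mul, mul_comm, add_comm]
    · ext <;> simp [Forms.diff, h1 (by omega)]
  graded_comm := by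
    rintro i j a b ⟨h1, h2⟩ ⟨h3, h4⟩
    rcases Nat.eq_zero_or_pos i with rfl | hi
    · simp [mul_comm]
    rcases Nat.eq_zero_or_pos j with rfl | hj
    · simp [mul_comm]
    ext <;> simp [h1 (by omega), h3 (by omega)]

/-- The map `id · ε_s : A ⊗ Λ(t, dt) → A`, where `ε_s (t) = s` and `ε_s (dt) = 0`. -/
def evalAt (A : CDGA.{u}) (s : ℚ) : A.tensor interval →ₐ[ℚ] A :=
  GradedTensorProduct.lift A.grading Forms.grading (AlgHom.id ℚ A)
    ((Algebra.ofId ℚ A).comp (Forms.eval s)) (by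
      intro i j a ω
      rcases Nat.eq_zero_or_pos j with rfl | hj
      · simpa using (Algebra.commutes _ _).symm
      · simp [Forms.eval_of_mem s (by omega) ω.2])

variable {A : CDGA.{u}} {B : CDGA.{v}}

/-- Two morphisms `f, g : A → B` are homotopic if there is a morphism of CDGAs
`Φ : A → B ⊗ Λ(t, dt)` with `(id · ε₀) Φ = f` and `(id · ε₁) Φ = g`. -/
def Homotopic (f g : Hom A B) : Prop :=
  ∃ Φ : Hom A (B.tensor interval),
    (∀ a, B.evalAt 0 (Φ.toAlgHom a) = f.toAlgHom a) ∧
    (∀ a, B.evalAt 1 (Φ.toAlgHom a) = g.toAlgHom a)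

/-- The set `[A, B]` of homotopy classes of morphisms `A → B`: the quotient of the set of morphisms
by the (equivalence relation generated by the) homotopy relation. -/
def HomotopyClasses (A : CDGA.{u}) (B : CDGA.{v}) : Type (max u v) :=
  Quot (Homotopic : Hom A B → Hom A B → Prop)

/-- The homotopy class of a morphism. -/
def homotopyClass (f : Hom A B) : HomotopyClasses A B := Quot.mk _ f

end Homotopy

end CDGA

/-! ### The algebras `ℳ_n(𝒢)` -/

/-- A digraph is strongly connected if every vertex can be reached from every vertex by a directed
path. -/
def Digraph.StronglyConnected {V : Type u} (G : Digraph V) : Prop :=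
  ∀ v w : V, Relation.ReflTransGen G.Adj v w

namespace DigraphModel

open CDGA CDGA.FreeGC

variable {V : Type u}

/-- The generators `x₁, x₂, y₁, y₂, y₃, z`, `x_v` for each vertex `v`, and `z_(v,w)` for each edge
`(v, w)`. -/
inductive Gen (G : Digraph V) : Type u
  | x₁ | x₂ | y₁ | y₂ | y₃ | z
  | vert (v : V)
  | edge (v w : V) (h : G.Adj v w)

variable (n : ℕ) (G : Digraph V)

/-- The degrees of the generators. -/
def deg : Gen G → ℕ
  | .x₁ => 30 * n + 18
  | .x₂ => 36 * n + 22
  | .y₁ => 126 * n + 75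
  | .y₂ => 132 * n + 79
  | .y₃ => 138 * n + 83
  | .z => 540 * n ^ 2 + 654 * n + 197
  | .vert _ => 180 * n ^ 2 + 218 * n + 66
  | .edge _ _ _ => 540 * n ^ 2 + 654 * n + 197

/-- A generator, as an element of the free graded commutative algebra. -/
def g (a : Gen G) : FreeGC (deg n G) := gen (deg n G) a

open Gen in
/-- The values of the differential on the generators. -/
def dGen : Gen G → FreeGC (deg n G)
  | .x₁ => 0
  | .x₂ => 0
  | .y₁ => g n G x₁ ^ 3 * g n G x₂
  | .y₂ => g n G x₁ ^ 2 * g n G x₂ ^ 2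
  | .y₃ => g n G x₁ * g n G x₂ ^ 3
  | .z => g n G x₁ ^ (18 * n) * (g n G x₂ ^ 2 * g n G y₁ * g n G y₂
        - g n G x₁ * g n G x₂ * g n G y₁ * g n G y₃ + g n G x₁ ^ 2 * g n G y₂ * g n G y₃)
      + g n G x₁ ^ (18 * n + 11) + g n G x₂ ^ (15 * n + 9)
  | .vert _ => 0
  | .edge v w _ => g n G (vert v) ^ 3 + g n G (vert v) * g n G (vert w) * g n G x₂ ^ (5 * n + 3)
      + g n G x₁ ^ (18 * n + 11)

theorem mem_of_eq {k l : ℕ} {a : FreeGC (deg n G)} (ha : a ∈ grade (deg n G) k) (h : k = l) :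
    a ∈ grade (deg n G) l := h ▸ ha

open Gen in
theorem dGen_mem (a : Gen G) : dGen n G a ∈ grade (deg n G) (deg n G a + 1) := by
  have m : ∀ a, g n G a ∈ grade (deg n G) (deg n G a) := gen_mem _
  have p : ∀ (k : ℕ) a, g n G a ^ k ∈ grade (deg n G) (k * deg n G a) := fun k a =>
    mem_of_eq n G (SetLike.pow_mem_graded k (m a)) (by simp)
  have c : ∀ {i j : ℕ} {a b : FreeGC (deg n G)}, a ∈ grade (deg n G) i → b ∈ grade (deg n G) j →
    a * b ∈ grade (deg n G) (i + j) := fun h h' => SetLike.mul_mem_graded h h'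
  cases a with
  | x₁ => exact zero_mem _
  | x₂ => exact zero_mem _
  | vert v => exact zero_mem _
  | y₁ => exact mem_of_eq n G (c (p 3 x₁) (m x₂)) (by simp only [deg]; ring)
  | y₂ => exact mem_of_eq n G (c (p 2 x₁) (p 2 x₂)) (by simp only [deg]; ring)
  | y₃ => exact mem_of_eq n G (c (m x₁) (p 3 x₂)) (by simp only [deg]; ring)
  | z =>
    refine add_mem (add_mem ?_ ?_) ?_
    · rw [mul_add, mul_sub]
      refine add_mem (sub_mem ?_ ?_) ?_
      · exact mem_of_eq n G (c (p (18 * n) x₁) (c (c (p 2 x₂) (m y₁)) (m y₂)))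
          (by simp only [deg]; ring)
      · exact mem_of_eq n G (c (p (18 * n) x₁) (c (c (c (m x₁) (m x₂)) (m y₁)) (m y₃)))
          (by simp only [deg]; ring)
      · exact mem_of_eq n G (c (p (18 * n) x₁) (c (c (p 2 x₁) (m y₂)) (m y₃)))
          (by simp only [deg]; ring)
    · exact mem_of_eq n G (p (18 * n + 11) x₁) (by simp only [deg]; ring)
    · exact mem_of_eq n G (p (15 * n + 9) x₂) (by simp only [deg]; ring)
  | edge v w h =>
    refine add_mem (add_mem ?_ ?_) ?_
    · exact mem_of_eq n G (p 3 (vert v)) (by simp only [deg]; ring)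
    · exact mem_of_eq n G (c (c (m (vert v)) (m (vert w))) (p (5 * n + 3) x₂))
        (by simp only [deg]; ring)
    · exact mem_of_eq n G (p (18 * n + 11) x₁) (by simp only [deg]; ring)

/-- The differential of `ℳ_n(G)`. -/
def diff : FreeGC (deg n G) →ₗ[ℚ] FreeGC (deg n G) :=
  FreeGC.diff (deg n G) (dGen n G) (dGen_mem n G)

theorem diff_g (a : Gen G) : diff n G (g n G a) = dGen n G a := diff_gen _ _ _ _

theorem diff_mul_even {a : FreeGC (deg n G)} {k : ℕ} (b : FreeGC (deg n G))
    (ha : a ∈ grade (deg n G) k) (hk : Even k) :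
    diff n G (a * b) = diff n G a * b + a * diff n G b := by
  rw [diff, diff_mul, sgn_of_mem _ ha, hk.neg_one_pow, one_smul]

theorem diff_mul_odd {a : FreeGC (deg n G)} {k : ℕ} (b : FreeGC (deg n G))
    (ha : a ∈ grade (deg n G) k) (hk : Odd k) :
    diff n G (a * b) = diff n G a * b - a * diff n G b := by
  rw [diff, diff_mul, sgn_of_mem _ ha, hk.neg_one_pow, neg_smul, one_smul, neg_mul, sub_eq_add_neg]

/-- Multiplication by a closed generator of even degree commutes with the differential. -/
theorem diff_closed_mul {a : Gen G} (h0 : dGen n G a = 0) (he : Even (deg n G a))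
    (b : FreeGC (deg n G)) : diff n G (g n G a * b) = g n G a * diff n G b := by
  have ha : g n G a ∈ grade (deg n G) (deg n G a) := gen_mem _ a
  rw [diff_mul_even n G b ha he, diff_g, h0, zero_mul, zero_add]

theorem diff_closed_pow_mul {a : Gen G} (h0 : dGen n G a = 0) (he : Even (deg n G a)) (k : ℕ)
    (b : FreeGC (deg n G)) : diff n G (g n G a ^ k * b) = g n G a ^ k * diff n G b := by
  induction k with
  | zero => simp
  | succ k ih => rw [pow_succ', mul_assoc, diff_closed_mul n G h0 he, ih, mul_assoc]

theorem diff_one : diff n G 1 = 0 := by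
  have := diff_algebraMap (deg n G) (dGen n G) (dGen_mem n G) 1
  rwa [map_one] at this

theorem diff_closed_pow {a : Gen G} (h0 : dGen n G a = 0) (he : Even (deg n G a)) (k : ℕ) :
    diff n G (g n G a ^ k) = 0 := by
  rw [← mul_one (g n G a ^ k), diff_closed_pow_mul n G h0 he, diff_one, mul_zero]

theorem even_comm {a : Gen G} (he : Even (deg n G a)) (b : Gen G) :
    g n G b * g n G a = g n G a * g n G b := by
  rw [g, g, gen_swap, (he.mul_left _).neg_one_pow, one_smul]

open Gen in
theorem diff_dGen (a : Gen G) : diff n G (dGen n G a) = 0 := by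
  have e₁ : Even (deg n G x₁) := ⟨15 * n + 9, by simp only [deg]; ring⟩
  have e₂ : Even (deg n G x₂) := ⟨18 * n + 11, by simp only [deg]; ring⟩
  have ev : ∀ v, Even (deg n G (vert v)) := fun v =>
    ⟨90 * n ^ 2 + 109 * n + 33, by simp only [deg]; ring⟩
  have o₁ : Odd (deg n G y₁) := ⟨63 * n + 37, by simp only [deg]; ring⟩
  have o₂ : Odd (deg n G y₂) := ⟨66 * n + 39, by simp only [deg]; ring⟩
  have p₁ := diff_closed_pow n G (a := x₁) rfl e₁
  have p₂ := diff_closed_pow n G (a := x₂) rfl e₂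
  have pm₁ := diff_closed_pow_mul n G (a := x₁) rfl e₁
  have pm₂ := diff_closed_pow_mul n G (a := x₂) rfl e₂
  have m₁ := diff_closed_mul n G (a := x₁) rfl e₁
  have m₂ := diff_closed_mul n G (a := x₂) rfl e₂
  cases a with
  | x₁ => exact map_zero _
  | x₂ => exact map_zero _
  | vert v => exact map_zero _
  | y₁ => rw [dGen, pm₁, diff_g, dGen, mul_zero]
  | y₂ => rw [dGen, pm₁, p₂, mul_zero]
  | y₃ => rw [dGen, m₁, p₂, mul_zero]
  | edge v w h =>
    rw [dGen, map_add, map_add, p₁, mul_assoc, diff_closed_mul n G rfl (ev v),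
      diff_closed_mul n G rfl (ev w), p₂, diff_closed_pow n G rfl (ev v)]
    simp
  | z =>
    have d₁₂ := diff_mul_odd n G (g n G y₂) (gen_mem _ y₁) o₁
    have d₁₃ := diff_mul_odd n G (g n G y₃) (gen_mem _ y₁) o₁
    have d₂₃ := diff_mul_odd n G (g n G y₃) (gen_mem _ y₂) o₂
    change diff n G (g n G y₁ * g n G y₂) = diff n G (g n G y₁) * g n G y₂
      - g n G y₁ * diff n G (g n G y₂) at d₁₂
    change diff n G (g n G y₁ * g n G y₃) = diff n G (g n G y₁) * g n G y₃
      - g n G y₁ * diff n G (g n G y₃) at d₁₃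
    change diff n G (g n G y₂ * g n G y₃) = diff n G (g n G y₂) * g n G y₃
      - g n G y₂ * diff n G (g n G y₃) at d₂₃
    simp only [diff_g, dGen] at d₁₂ d₁₃ d₂₃
    rw [dGen, map_add, map_add, p₁, p₂, pm₁, map_add, map_sub]
    simp only [mul_assoc]
    rw [pm₂, m₁, m₂, pm₁, d₁₂, d₁₃, d₂₃]
    have c₁ := even_comm n G e₁
    have c₂ := even_comm n G e₂
    have c₁' : ∀ b t, g n G b * (g n G x₁ * t) = g n G x₁ * (g n G b * t) := fun b t => by
      rw [← mul_assoc, c₁, mul_assoc]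
    have c₂' : ∀ b t, g n G b * (g n G x₂ * t) = g n G x₂ * (g n G b * t) := fun b t => by
      rw [← mul_assoc, c₂, mul_assoc]
    have q : g n G x₂ ^ 2 * (g n G x₁ ^ 3 * g n G x₂ * g n G y₂
          - g n G y₁ * (g n G x₁ ^ 2 * g n G x₂ ^ 2))
        - g n G x₁ * (g n G x₂ * (g n G x₁ ^ 3 * g n G x₂ * g n G y₃
          - g n G y₁ * (g n G x₁ * g n G x₂ ^ 3)))
        + g n G x₁ ^ 2 * (g n G x₁ ^ 2 * g n G x₂ ^ 2 * g n G y₃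
          - g n G y₂ * (g n G x₁ * g n G x₂ ^ 3)) = 0 := by
      simp only [pow_succ, pow_zero, one_mul, mul_assoc, mul_sub, c₂ y₁, c₂ y₂,
        c₁' y₁, c₁' y₂, c₂' y₁, c₂' y₂, c₁' x₂]
      abel
    simp only [mul_assoc] at q ⊢
    rw [q]
    simp

end DigraphModel

/-- The minimal Sullivan algebra `ℳ_n(G)` of a digraph `G`. -/
def Digraph.model {V : Type u} (n : ℕ) (G : Digraph V) : CDGA.{u} :=
  CDGA.FreeGC.cdga (DigraphModel.deg n G) (DigraphModel.dGen n G) (DigraphModel.dGen_mem n G)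
    (DigraphModel.diff_dGen n G)

end

/-! The argument is Stokes' formula on the interval combined with a degree count. Let `Φ` be a
homotopy from `f` to `g` and let `x` be a generator of the source. Integrating `Φ (d x) = d (Φ x)`
over the interval gives, up to sign, `g x - f x = ∫ Φ (d x) - d (∫ Φ x)`, so `f x = g x` once both
terms on the right vanish (`Hom.apply_eq_of_homotopy`).

The first term vanishes because `Φ (d x)` involves no `dt`. Every `d x` is a polynomial in the
`x_i`, `y_i` and `x_v`, and for such a generator `y` the `dt`-part of `Φ y` has its coefficients in
the target's degree `|y| - 1`, which is zero (`eq_zero_of_mem_grade`). The second vanishes because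
`∫ Φ x` has degree `|x| - 1`, where the target's differential is zero (`diff_eq_zero_of_mem_grade`).
For `z` and `z_(v,w)` that degree is not zero, but all its nonzero monomials are products of the
closed generators `x_i` and `x_v`.

Both degree statements rest on `|x₁| = 6(5n+3)`, `|x₂| = 2(18n+11)`, `|x_v| = 2(5n+3)(18n+11)` and
`|z| + 1 = 3|x_v|`, together with the coprimality of `3(5n+3)` and `18n+11`. Since `|y_i| + 1` is an
explicit combination of `|x₁|` and `|x₂|`, a monomial containing some `y_i` yields an equation
`A·3(5n+3) + B(18n+11) = m(18n+11)` with `A, B > 0`; then `18n+11` divides `A`, which makes the left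
side too large. Only the fact that monomials span is needed, not their linear independence. -/

noncomputable section

namespace CDGA

/-! ### Evaluation and integration of forms on the interval -/

namespace interval

/-- The function `p(t)` as an element of degree `0` of `Λ(t, dt)`. -/
def poly (p : Polynomial ℚ) : interval := (TrivSqZeroExt.inl p : Forms)

theorem poly_mem (p : Polynomial ℚ) : poly p ∈ interval.grading 0 := Forms.inl_mem p

theorem poly_mul (p q : Polynomial ℚ) : poly p * poly q = poly (p * q) :=
  (TrivSqZeroExt.inl_mul (M := Polynomial ℚ) p q).symm

theorem eq_poly {ω : interval} (h : ω ∈ interval.grading 0) : ∃ p, ω = poly p :=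
  ⟨TrivSqZeroExt.fst (R := Polynomial ℚ) (M := Polynomial ℚ) ω,
    TrivSqZeroExt.ext rfl (h.2 zero_ne_one)⟩

theorem eq_zero_of_mem {k : ℕ} (hk : 1 < k) {ω : interval} (h : ω ∈ interval.grading k) : ω = 0 :=
  TrivSqZeroExt.ext (h.1 (by omega)) (h.2 (by omega))

/-- The evaluation `p(t) + q(t) dt ↦ p(s)`. -/
def eval (s : ℚ) : interval →ₗ[ℚ] ℚ := (Forms.eval s).toLinearMap

theorem eval_one (s : ℚ) : eval s 1 = 1 := map_one (Forms.eval s)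

theorem eval_of_mem (s : ℚ) {k : ℕ} (hk : k ≠ 0) {ω : interval} (h : ω ∈ interval.grading k) :
    eval s ω = 0 := Forms.eval_of_mem s hk h

/-- The integral `p(t) + q(t) dt ↦ ∫₀¹ q(t) dt`. -/
def integral : interval →ₗ[ℚ] ℚ :=
  (Polynomial.lsum fun k => ((k : ℚ) + 1)⁻¹ • LinearMap.id) ∘ₗ
    (TrivSqZeroExt.sndHom (Polynomial ℚ) (Polynomial ℚ)).restrictScalars ℚ

theorem integral_of_mem {k : ℕ} (hk : k ≠ 1) {ω : interval} (h : ω ∈ interval.grading k) :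
    integral ω = 0 := by
  change Polynomial.lsum _ (TrivSqZeroExt.snd (R := Polynomial ℚ) (M := Polynomial ℚ) ω) = 0
  rw [h.2 hk, map_zero]

/-- The fundamental theorem of calculus. -/
theorem integral_d (ω : interval) : integral (interval.d ω) = eval 1 ω - eval 0 ω := by
  have key (p : Polynomial ℚ) : Polynomial.lsum (fun k => ((k : ℚ) + 1)⁻¹ • LinearMap.id (R := ℚ))
      (Polynomial.derivative p) = Polynomial.aeval 1 p - Polynomial.aeval (0 : ℚ) p := by
    induction p using Polynomial.induction_on' with
    | add p q hp hq => simp only [map_add, hp, hq]; ring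
    | monomial k a =>
      rw [Polynomial.derivative_monomial, Polynomial.lsum_apply,
        Polynomial.sum_monomial_index _ _ (by simp)]
      rcases k with _ | k
      · simp
      · have : (k : ℚ) + 1 ≠ 0 := by positivity
        simp
        field_simp
  exact key (TrivSqZeroExt.fst (R := Polynomial ℚ) (M := Polynomial ℚ) ω)

theorem d_one : interval.d 1 = 0 := by
  change Forms.diff 1 = 0
  simp [Forms.diff]

end interval

/-! ### Integration over the fibre, and the elements without `dt` -/

section

variable (B : CDGA.{u})

/-- Integration over the fibre `B ⊗ Λ(t, dt) → B`. -/
def integrate : TensorCarrier B interval →ₗ[ℚ] B :=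
  (TensorProduct.rid ℚ B).toLinearMap ∘ₗ TensorProduct.map LinearMap.id interval.integral ∘ₗ
    (GradedTensorProduct.of ℚ B.grading interval.grading).symm.toLinearMap

theorem integrate_tm (b : B) (ω : interval) :
    B.integrate (tm B interval b ω) = interval.integral ω • b := rfl

/-- The linear map underlying `id · ε_s`. -/
def evalAtLinear (s : ℚ) : TensorCarrier B interval →ₗ[ℚ] B := (B.evalAt s).toLinearMap

theorem evalAtLinear_tm (s : ℚ) (b : B) (ω : interval) :
    B.evalAtLinear s (tm B interval b ω) = interval.eval s ω • b := by
  -- Phrased over `Forms`, where `evalAt` is defined; the carrier of `interval` unfolds to it.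
  have h (ω : Forms) : B.evalAt s (tm B interval b ω) = Forms.eval s ω • b := by
    refine (GradedTensorProduct.lift_tmul _ _ _ _ _ _ _).trans ?_
    rw [Algebra.smul_def, Algebra.commutes]
    rfl
  exact h ω

/-- Stokes' formula. -/
theorem integrate_tensorDiff {k : ℕ} {x : TensorCarrier B interval}
    (hx : x ∈ tensorGrading B interval k) :
    B.integrate (tensorDiff B interval x) - B.d (B.integrate x)
      = (-1 : ℚ) ^ k • (B.evalAtLinear 1 x - B.evalAtLinear 0 x) := by
  refine Submodule.span_induction (p := fun x _ => B.integrate (tensorDiff B interval x)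
    - B.d (B.integrate x) = (-1 : ℚ) ^ k • (B.evalAtLinear 1 x - B.evalAtLinear 0 x))
    ?_ ?_ ?_ ?_ hx
  · rintro _ ⟨i, j, rfl, b, hb, ω, hω, rfl⟩
    rw [tensorDiff_tm B interval ω hb, map_add, map_smul, integrate_tm, integrate_tm, integrate_tm,
      evalAtLinear_tm, evalAtLinear_tm, map_smul, add_sub_cancel_left, ← sub_smul,
      interval.integral_d]
    -- Only functions, `j = 0`, have nonzero boundary values, and then `i = k` matches the two
    -- signs.
    rcases Nat.eq_zero_or_pos j with rfl | hj
    · rfl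
    · simp [interval.eval_of_mem _ hj.ne' hω]
  · simp
  · intro x y _ _ h h'
    simp only [map_add, add_sub_add_comm, h, h', smul_add]
  · intro r x _ h
    simp only [map_smul, ← smul_sub, h, smul_comm r]

/-- Only the `dt`-part contributes to the integral, and removing `dt` lowers the degree by one. -/
theorem integrate_mem {k : ℕ} {x : TensorCarrier B interval}
    (hx : x ∈ tensorGrading B interval (k + 1)) : B.integrate x ∈ B.grading k := by
  refine Submodule.span_induction (p := fun x _ => B.integrate x ∈ B.grading k) ?_ ?_ ?_ ?_ hx
  · rintro _ ⟨i, j, hij, b, hb, ω, hω, rfl⟩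
    rw [integrate_tm]
    by_cases hj : j = 1
    · obtain rfl : i = k := by omega
      exact Submodule.smul_mem _ _ hb
    · rw [interval.integral_of_mem hj hω, zero_smul]
      exact zero_mem _
  · simp
  · intro x y _ _ h h'; rw [map_add]; exact add_mem h h'
  · intro r x _ h; rw [map_smul]; exact Submodule.smul_mem _ _ h

/-- The subspace `B ⊗ ℚ[t]` of `B ⊗ Λ(t, dt)`. -/
def polySubmodule : Submodule ℚ (TensorCarrier B interval) :=
  Submodule.span ℚ {x | ∃ i, ∃ b ∈ B.grading i, ∃ p : Polynomial ℚ,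
    x = tm B interval b (interval.poly p)}

/-- The subalgebra `B ⊗ ℚ[t]` of `B ⊗ Λ(t, dt)`. -/
def polySubalgebra : Subalgebra ℚ (TensorCarrier B interval) :=
  B.polySubmodule.toSubalgebra
    (Submodule.subset_span ⟨0, 1, SetLike.one_mem_graded B.grading, 1, rfl⟩) (by
      intro x y hx hy
      refine Submodule.span_induction₂ (p := fun x y _ _ => x * y ∈ B.polySubmodule)
        ?_ ?_ ?_ ?_ ?_ ?_ ?_ hx hy
      · rintro _ _ ⟨i, b, hb, p, rfl⟩ ⟨j, b', hb', q, rfl⟩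
        refine Submodule.subset_span ⟨i + j, b * b', SetLike.mul_mem_graded hb hb', p * q, ?_⟩
        -- Functions of `t` have degree `0`, so the Koszul sign is trivial.
        rw [tm_mul B interval b _ (interval.poly_mem p) hb', zero_mul, pow_zero, one_smul,
          interval.poly_mul]
      · intros; simp
      · intros; simp
      · intro x y z _ _ _ h h'; rw [add_mul]; exact add_mem h h'
      · intro x y z _ _ _ h h'; rw [mul_add]; exact add_mem h h'
      · intro r x y _ _ h; rw [smul_mul_assoc]; exact Submodule.smul_mem _ _ h
      · intro r x y _ _ h; rw [mul_smul_comm]; exact Submodule.smul_mem _ _ h)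

theorem integrate_of_mem_polySubalgebra {x : TensorCarrier B interval}
    (hx : x ∈ B.polySubalgebra) : B.integrate x = 0 := by
  refine Submodule.span_induction (p := fun x _ => B.integrate x = 0) ?_ ?_ ?_ ?_ hx
  · rintro _ ⟨i, b, hb, p, rfl⟩
    rw [integrate_tm, interval.integral_of_mem zero_ne_one (interval.poly_mem p), zero_smul]
  · simp
  · intro x y _ _ h h'; rw [map_add, h, h', add_zero]
  · intro r x _ h; rw [map_smul, h, smul_zero]

/-- In degree `k + 1` the tensor product is `B^(k+1) ⊗ ℚ[t] ⊕ B^k ⊗ ℚ[t] dt`, and the hypothesis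
kills the second summand. -/
theorem mem_polySubalgebra {k : ℕ} (hB : ∀ b ∈ B.grading k, b = 0) {x : TensorCarrier B interval}
    (hx : x ∈ tensorGrading B interval (k + 1)) : x ∈ B.polySubalgebra := by
  refine Submodule.span_induction (p := fun x _ => x ∈ B.polySubalgebra) ?_ ?_ ?_ ?_ hx
  · rintro _ ⟨i, j, hij, b, hb, ω, hω, rfl⟩
    rcases j with _ | _ | j
    · obtain ⟨p, rfl⟩ := interval.eq_poly hω
      exact Submodule.subset_span ⟨i, b, hb, p, rfl⟩
    · obtain rfl : i = k := by omega
      rw [hB b hb, tm_zero_left]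
      exact zero_mem _
    · rw [interval.eq_zero_of_mem (by omega) hω, tm_zero_right]
      exact zero_mem _
  · exact zero_mem _
  · intro x y _ _ h h'; exact add_mem h h'
  · intro r x _ h; exact Subalgebra.smul_mem _ h r

end

/-! ### Homotopies and Stokes' formula -/

variable {A : CDGA.{u}} {B : CDGA.{v}}

theorem Hom.ext_toAlgHom {f g : Hom A B} (h : f.toAlgHom = g.toAlgHom) : f = g := by
  cases f; cases g; cases h; rfl

/-- A homotopy, as a morphism to the carrier of `B ⊗ Λ(t, dt)`. -/
def Hom.homotopyMap (Φ : Hom A (B.tensor interval)) : A →ₐ[ℚ] TensorCarrier B interval :=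
  Φ.toAlgHom

theorem Hom.homotopyMap_mem (Φ : Hom A (B.tensor interval)) {k : ℕ} {a : A}
    (ha : a ∈ A.grading k) : Φ.homotopyMap a ∈ tensorGrading B interval k := Φ.map_mem ha

theorem Hom.homotopyMap_d (Φ : Hom A (B.tensor interval)) (a : A) :
    Φ.homotopyMap (A.d a) = tensorDiff B interval (Φ.homotopyMap a) := Φ.map_d a

theorem tensorDiff_tm_one (b : B) :
    tensorDiff B interval (tm B interval b 1) = tm B interval (B.d b) 1 := by
  change tm B interval (B.d b) 1 + tm B interval (B.sgn b) (interval.d 1) = _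
  rw [interval.d_one, tm_zero_right, add_zero]

theorem evalAtLinear_tm_one (s : ℚ) (b : B) : B.evalAtLinear s (tm B interval b 1) = b := by
  rw [evalAtLinear_tm, interval.eval_one, one_smul]

/-- The algebra morphism `a ↦ f a ⊗ 1`. -/
def Hom.tmOne (f : Hom A B) : A →ₐ[ℚ] TensorCarrier B interval :=
  (GradedTensorProduct.includeLeft B.grading interval.grading).comp f.toAlgHom

theorem Hom.tmOne_apply (f : Hom A B) (a : A) : f.tmOne a = tm B interval (f.toAlgHom a) 1 := rfl

theorem Hom.tmOne_mem (f : Hom A B) {k : ℕ} {a : A} (ha : a ∈ A.grading k) :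
    f.tmOne a ∈ tensorGrading B interval k := by
  have hb : f.toAlgHom a ∈ B.grading k := f.map_mem ha
  have h1 : (1 : interval) ∈ interval.grading 0 := SetLike.one_mem_graded interval.grading
  have h2 : tm B interval (f.toAlgHom a) 1 ∈ tensorGrading B interval (k + 0) :=
    tm_mem B interval hb h1
  rw [add_zero] at h2
  rw [tmOne_apply]
  exact h2

theorem Hom.tmOne_d (f : Hom A B) (a : A) :
    f.tmOne (A.d a) = tensorDiff B interval (f.tmOne a) := by
  have h : f.toAlgHom (A.d a) = B.d (f.toAlgHom a) := f.map_d a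
  rw [tmOne_apply, tmOne_apply, h, tensorDiff_tm_one]

/-- The constant homotopy. -/
def Hom.constHomotopy (f : Hom A B) : Hom A (B.tensor interval) where
  toAlgHom := f.tmOne
  map_mem := f.tmOne_mem
  map_d := f.tmOne_d

theorem Homotopic.refl (f : Hom A B) : Homotopic f f :=
  ⟨f.constHomotopy, fun a => evalAtLinear_tm_one 0 (f.toAlgHom a),
    fun a => evalAtLinear_tm_one 1 (f.toAlgHom a)⟩

/-- Along a homotopy `Φ` from `f` to `g`, the morphisms agree on an element `a` of degree `k + 1`
if `d` vanishes on `B ^ k` and `Φ (d a)` involves no `dt`. -/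
theorem Hom.apply_eq_of_homotopy {f g : Hom A B} {Φ : Hom A (B.tensor interval)}
    (h₀ : ∀ a, B.evalAt 0 (Φ.toAlgHom a) = f.toAlgHom a)
    (h₁ : ∀ a, B.evalAt 1 (Φ.toAlgHom a) = g.toAlgHom a) {k : ℕ} {a : A}
    (ha : a ∈ A.grading (k + 1)) (hB : ∀ b ∈ B.grading k, B.d b = 0)
    (hΦ : Φ.homotopyMap (A.d a) ∈ B.polySubalgebra) : f.toAlgHom a = g.toAlgHom a := by
  have e₀ : B.evalAtLinear 0 (Φ.homotopyMap a) = f.toAlgHom a := h₀ a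
  have e₁ : B.evalAtLinear 1 (Φ.homotopyMap a) = g.toAlgHom a := h₁ a
  have hm := Φ.homotopyMap_mem ha
  have h := integrate_tensorDiff B hm
  -- Both terms on the left of Stokes' formula vanish: the integral of `Φ (d a)` by `hΦ`, and the
  -- differential of the integral of `Φ a` by `hB`, as that integral has degree `k`.
  rw [← Φ.homotopyMap_d, integrate_of_mem_polySubalgebra B hΦ, hB _ (integrate_mem B hm), sub_zero,
    e₀, e₁, eq_comm, smul_eq_zero_iff_right (by simp), sub_eq_zero] at h
  exact h.symm

/-- The hypothesis lets the identity descend to the quotient, where it is a left inverse of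
`homotopyClass`. Symmetry and transitivity of homotopy are not needed. -/
theorem homotopyClass_bijective (h : ∀ f g : Hom A B, Homotopic f g → f = g) :
    Function.Bijective (homotopyClass : Hom A B → HomotopyClasses A B) :=
  ⟨fun _ _ hfg => congrArg (Quot.lift id h) hfg, Quot.mk_surjective⟩

end CDGA

/-! ### Monomials in free graded commutative algebras -/

namespace CDGA.FreeGC

variable {X : Type u} (deg : X → ℕ)

/-- Moving `x` past the other letters costs only signs until it meets its second copy, and `x ^ 2 =
-x ^ 2` forces `x ^ 2 = 0` over `ℚ`. -/
theorem gen_mul_mono_eq_zero {x : X} (hx : Odd (deg x)) {l : List X} (h : x ∈ l) :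
    gen deg x * mono deg l = 0 := by
  induction l with
  | nil => simp at h
  | cons y l ih =>
    rw [mono_cons, ← mul_assoc]
    by_cases hxy : x = y
    · subst hxy
      have h2 := gen_swap deg x x
      rw [(hx.mul hx).neg_one_pow, neg_smul, one_smul, eq_neg_iff_add_eq_zero, ← two_smul ℚ,
        smul_eq_zero_iff_right two_ne_zero] at h2
      rw [h2, zero_mul]
    · rw [gen_swap, smul_mul_assoc, mul_assoc, ih ((List.mem_cons.1 h).resolve_left hxy), mul_zero,
        smul_zero]

/-- A monomial in which a generator of odd degree is repeated vanishes. -/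
theorem mono_eq_zero {x : X} (hx : Odd (deg x)) {l : List X} (h : List.Duplicate x l) :
    mono deg l = 0 := by
  induction h with
  | cons_mem h => rw [mono_cons, gen_mul_mono_eq_zero deg hx h]
  | cons_duplicate _ ih => rw [mono_cons, ih, mul_zero]

/-- A linear map vanishes on a homogeneous part as soon as it vanishes on its monomials. -/
theorem eq_zero_of_mono {M : Type*} [AddCommGroup M] [Module ℚ M] (φ : FreeGC deg →ₗ[ℚ] M) {k : ℕ}
    (h : ∀ l : List X, (l.map deg).sum = k → φ (mono deg l) = 0) {a : FreeGC deg}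
    (ha : a ∈ grade deg k) : φ a = 0 := by
  refine Submodule.span_induction (p := fun a _ => φ a = 0) ?_ ?_ ?_ ?_ ha
  · rintro _ ⟨l, hl, rfl⟩
    exact h l hl
  · exact map_zero φ
  · intro x y _ _ h h'; rw [map_add, h, h', add_zero]
  · intro r x _ h; rw [map_smul, h, smul_zero]

end CDGA.FreeGC

/-! ### Monomials of `ℳ_n(G)` and their exponents -/

namespace DigraphModel

open CDGA CDGA.FreeGC

variable {V : Type u} (n : ℕ) (G : Digraph V)

open Gen in
-- Reduces questions about degrees to arithmetic: `c` counts all the `x_v` together, and `e` counts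
-- `z` and all the `z_(v,w)`, since these share a degree. The last clause records that the remaining
-- letters `x_i` and `x_v` are closed and even.
theorem exists_exponents [DecidableEq (Gen G)] (l : List (Gen G)) : ∃ a b c e : ℕ,
    (l.map (deg n G)).sum = a * (30 * n + 18) + b * (36 * n + 22)
      + l.count y₁ * (126 * n + 75) + l.count y₂ * (132 * n + 79) + l.count y₃ * (138 * n + 83)
      + c * (180 * n ^ 2 + 218 * n + 66) + e * (540 * n ^ 2 + 654 * n + 197) ∧
    (e = 0 → l.count y₁ = 0 → l.count y₂ = 0 → l.count y₃ = 0 →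
      ∀ x ∈ l, dGen n G x = 0 ∧ Even (deg n G x)) := by
  have e₁ : Even (deg n G x₁) := ⟨15 * n + 9, by simp only [deg]; ring⟩
  have e₂ : Even (deg n G x₂) := ⟨18 * n + 11, by simp only [deg]; ring⟩
  have ev : ∀ v, Even (deg n G (vert v)) := fun v =>
    ⟨90 * n ^ 2 + 109 * n + 33, by simp only [deg]; ring⟩
  induction l with
  | nil => exact ⟨0, 0, 0, 0, by simp, by simp⟩
  | cons x l ih =>
    obtain ⟨a, b, c, e, h, h'⟩ := ih
    cases x with
    | x₁ =>
      refine ⟨a + 1, b, c, e, ?_, ?_⟩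
      · simp only [List.map_cons, List.sum_cons, h, deg]; simp; ring
      · intro k k₁ k₂ k₃
        simp at k₁ k₂ k₃
        simpa [e₁, dGen] using h' k k₁ k₂ k₃
    | x₂ =>
      refine ⟨a, b + 1, c, e, ?_, ?_⟩
      · simp only [List.map_cons, List.sum_cons, h, deg]; simp; ring
      · intro k k₁ k₂ k₃
        simp at k₁ k₂ k₃
        simpa [e₂, dGen] using h' k k₁ k₂ k₃
    | vert v =>
      refine ⟨a, b, c + 1, e, ?_, ?_⟩
      · simp only [List.map_cons, List.sum_cons, h, deg]; simp; ring
      · intro k k₁ k₂ k₃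
        simp at k₁ k₂ k₃
        simpa [ev, dGen] using h' k k₁ k₂ k₃
    | y₁ =>
      refine ⟨a, b, c, e, ?_, by simp⟩
      simp only [List.map_cons, List.sum_cons, h, deg]; simp; ring
    | y₂ =>
      refine ⟨a, b, c, e, ?_, by simp⟩
      simp only [List.map_cons, List.sum_cons, h, deg]; simp; ring
    | y₃ =>
      refine ⟨a, b, c, e, ?_, by simp⟩
      simp only [List.map_cons, List.sum_cons, h, deg]; simp; ring
    | z =>
      refine ⟨a, b, c, e + 1, ?_, by simp⟩
      simp only [List.map_cons, List.sum_cons, h, deg]; simp; ring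
    | edge v w hvw =>
      refine ⟨a, b, c, e + 1, ?_, by simp⟩
      simp only [List.map_cons, List.sum_cons, h, deg]; simp; ring

theorem diff_mono_eq_zero {l : List (Gen G)} (hl : ∀ x ∈ l, dGen n G x = 0 ∧ Even (deg n G x)) :
    diff n G (mono (deg n G) l) = 0 := by
  induction l with
  | nil => exact diff_one n G
  | cons x l ih =>
    rw [List.forall_mem_cons] at hl
    have := diff_closed_mul n G hl.1.1 hl.1.2 (mono (deg n G) l)
    rw [ih hl.2, mul_zero] at this
    rwa [mono_cons]

open Gen in
/-- Every monomial of `ℳ_n(G)` vanishes, or has exponents at most `1` at the `y_i`. -/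
theorem mono_cases (l : List (Gen G)) : mono (deg n G) l = 0 ∨ ∃ a b p q r c e : ℕ,
    p ≤ 1 ∧ q ≤ 1 ∧ r ≤ 1 ∧
    (l.map (deg n G)).sum = a * (30 * n + 18) + b * (36 * n + 22)
      + p * (126 * n + 75) + q * (132 * n + 79) + r * (138 * n + 83)
      + c * (180 * n ^ 2 + 218 * n + 66) + e * (540 * n ^ 2 + 654 * n + 197) ∧
    (e = 0 → p = 0 → q = 0 → r = 0 → diff n G (mono (deg n G) l) = 0) := by
  classical
  have o₁ : Odd (deg n G y₁) := ⟨63 * n + 37, by simp only [deg]; ring⟩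
  have o₂ : Odd (deg n G y₂) := ⟨66 * n + 39, by simp only [deg]; ring⟩
  have o₃ : Odd (deg n G y₃) := ⟨69 * n + 41, by simp only [deg]; ring⟩
  obtain ⟨a, b, c, e, h, h'⟩ := exists_exponents n G l
  rw [or_iff_not_imp_left]
  intro h0
  have key {y : Gen G} (hy : Odd (deg n G y)) : l.count y ≤ 1 := by
    by_contra! h2
    exact h0 (mono_eq_zero _ hy (List.duplicate_iff_two_le_count.2 h2))
  exact ⟨a, b, _, _, _, c, e, key o₁, key o₂, key o₃, h,
    fun k k₁ k₂ k₃ => diff_mono_eq_zero n G (h' k k₁ k₂ k₃)⟩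

/-! ### Degrees of monomials -/

/-- The two numbers are `|x₂| / 2` and `|x₁| / 2`. Bézout: `5(18n+11) - 6·3(5n+3) = 1`. -/
theorem vert_coprime : Nat.Coprime (18 * n + 11) (3 * (5 * n + 3)) := by
  rw [← Nat.isCoprime_iff_coprime]
  exact ⟨5, -6, by push_cast; ring⟩

variable {n} {a b p q r c e : ℕ}

/-- The total is `|z| - 1`, which is even, so an odd number of `y_i` is impossible. A product of two
of them has degree `s|x₁| + t|x₂| - 2` with `s, t > 0`; adding `2` and halving turns the right side
into `3(5n+3)(18n+11)`, which `key` excludes. -/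
theorem exponents_edge (hp : p ≤ 1) (hq : q ≤ 1) (hr : r ≤ 1)
    (h : a * (30 * n + 18) + b * (36 * n + 22)
      + p * (126 * n + 75) + q * (132 * n + 79) + r * (138 * n + 83)
      + c * (180 * n ^ 2 + 218 * n + 66) + e * (540 * n ^ 2 + 654 * n + 197)
      = 540 * n ^ 2 + 654 * n + 196) : e = 0 ∧ p = 0 ∧ q = 0 ∧ r = 0 := by
  obtain rfl : e = 0 := by
    by_contra he
    have := Nat.mul_le_mul_right (540 * n ^ 2 + 654 * n + 197) (Nat.one_le_iff_ne_zero.2 he)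
    omega
  refine ⟨rfl, ?_⟩
  have key (A B : ℕ) (hA : 0 < A) (hB : 0 < B)
      (h : A * (3 * (5 * n + 3)) + (B + c * (5 * n + 3)) * (18 * n + 11)
        = 3 * (5 * n + 3) * (18 * n + 11)) : False := by
    -- By coprimality `18n+11` divides `A`, so the first summand alone reaches the right side, while
    -- the second is positive.
    have hd : 18 * n + 11 ∣ A * (3 * (5 * n + 3)) :=
      (Nat.dvd_add_left (Dvd.intro_left _ rfl)).1 (h ▸ Dvd.intro_left _ rfl)
    have hle := Nat.le_of_dvd hA ((vert_coprime n).dvd_of_dvd_mul_right hd)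
    have h1 := Nat.mul_le_mul_right (3 * (5 * n + 3)) hle
    have h2 : 0 < (B + c * (5 * n + 3)) * (18 * n + 11) := by positivity
    linarith
  interval_cases p <;> interval_cases q <;> interval_cases r
  · simp
  · grind
  · grind
  -- The shifts come from `|y₂| + |y₃| = 3|x₁| + 5|x₂| - 2`; likewise `(4, 4)` for `y₁ y₃` and `(5,
  -- 3)` for `y₁ y₂`.
  · exact (key (a + 3) (b + 5) (by omega) (by omega) (by linarith)).elim
  · grind
  · exact (key (a + 4) (b + 4) (by omega) (by omega) (by linarith)).elim
  · exact (key (a + 5) (b + 3) (by omega) (by omega) (by linarith)).elim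
  · grind

/-- The total `|x_v| - 1` is odd and too small for any `x_v`, `z` or `z_(v,w)`, so one or three
`y_i` occur. With one, adding `1` and halving gives `(5n+3)(18n+11)` with positive coefficients on
the left, and divisibility by `18n+11` excludes this. -/
theorem exponents_vert (hp : p ≤ 1) (hq : q ≤ 1) (hr : r ≤ 1) :
    a * (30 * n + 18) + b * (36 * n + 22)
      + p * (126 * n + 75) + q * (132 * n + 79) + r * (138 * n + 83)
      + c * (180 * n ^ 2 + 218 * n + 66) + e * (540 * n ^ 2 + 654 * n + 197)
      ≠ 180 * n ^ 2 + 218 * n + 65 := by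
  intro h
  obtain rfl : e = 0 := by
    by_contra he
    have := Nat.mul_le_mul_right (540 * n ^ 2 + 654 * n + 197) (Nat.one_le_iff_ne_zero.2 he)
    omega
  obtain rfl : c = 0 := by
    by_contra hc
    have := Nat.mul_le_mul_right (180 * n ^ 2 + 218 * n + 66) (Nat.one_le_iff_ne_zero.2 hc)
    omega
  have key (A B : ℕ) (hA : 0 < A) (hB : 0 < B)
      (h : A * (3 * (5 * n + 3)) + B * (18 * n + 11) = (5 * n + 3) * (18 * n + 11)) : False := by
    have hd : 18 * n + 11 ∣ A * (3 * (5 * n + 3)) :=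
      (Nat.dvd_add_left (Dvd.intro_left _ rfl)).1 (h ▸ Dvd.intro_left _ rfl)
    have hle := Nat.le_of_dvd hA ((vert_coprime n).dvd_of_dvd_mul_right hd)
    have h1 := Nat.mul_le_mul_right (3 * (5 * n + 3)) hle
    nlinarith
  interval_cases p <;> interval_cases q <;> interval_cases r
  · grind
  -- Here `|y₃| = |x₁| + 3|x₂| - 1`; for `y₂` and `y₁` the shifts are `(2, 2)` and `(3, 1)`.
  · exact key (a + 1) (b + 3) (by omega) (by omega) (by linarith)
  · exact key (a + 2) (b + 2) (by omega) (by omega) (by linarith)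
  · grind
  · exact key (a + 3) (b + 1) (by omega) (by omega) (by linarith)
  · grind
  · grind
  -- As `|y₁| + |y₂| + |y₃| = 6|x₁| + 6|x₂| - 3`, halving leaves `(5n+3)(18n+11) + 1` on the right.
  -- Writing this `1` as `5(18n+11) - 6·3(5n+3)` turns `a + 6` into `a + 12` and `5n + 3` into `5n +
  -- 8`.
  · have h' : (a + 12) * (3 * (5 * n + 3)) + (b + 6) * (18 * n + 11)
        = (5 * n + 8) * (18 * n + 11) := by linarith
    have hd : 18 * n + 11 ∣ (a + 12) * (3 * (5 * n + 3)) :=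
      (Nat.dvd_add_left (Dvd.intro_left _ rfl)).1 (h' ▸ Dvd.intro_left _ rfl)
    have hle := Nat.le_of_dvd (by omega) ((vert_coprime n).dvd_of_dvd_mul_right hd)
    have h1 := Nat.mul_le_mul_right (3 * (5 * n + 3)) hle
    nlinarith

/-- The values of `k` are `|x_i| - 1` and `|y_i| - 1`. They are linear in `n` and so small that only
finitely many exponents are possible. -/
theorem exponents_small {k : ℕ} (hn : 1 ≤ n) (hp : p ≤ 1) (hq : q ≤ 1) (hr : r ≤ 1)
    (hk : k = 30 * n + 17 ∨ k = 36 * n + 21 ∨ k = 126 * n + 74 ∨ k = 132 * n + 78 ∨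
      k = 138 * n + 82) :
    a * (30 * n + 18) + b * (36 * n + 22)
      + p * (126 * n + 75) + q * (132 * n + 79) + r * (138 * n + 83)
      + c * (180 * n ^ 2 + 218 * n + 66) + e * (540 * n ^ 2 + 654 * n + 197) ≠ k := by
  intro h
  have he : e = 0 := by
    by_contra he
    have := Nat.mul_le_mul_right (540 * n ^ 2 + 654 * n + 197) (Nat.one_le_iff_ne_zero.2 he)
    omega
  have hc : c = 0 := by
    by_contra hc
    have := Nat.mul_le_mul_right (180 * n ^ 2 + 218 * n + 66) (Nat.one_le_iff_ne_zero.2 hc)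
    -- Makes the bound `|x_v| > k` linear in `n`. It needs `1 ≤ n`: at `n = 0` the degree `66` lies
    -- below `82`.
    have := Nat.le_self_pow two_ne_zero n
    omega
  subst he hc
  -- Both `5|x₁|` and `4|x₂|` exceed `138n + 82`, the largest `k`.
  have ha : a ≤ 4 := by
    by_contra! ha
    have := Nat.mul_le_mul_right (30 * n + 18) (Nat.succ_le_of_lt ha)
    omega
  have hb : b ≤ 3 := by
    by_contra! hb
    have := Nat.mul_le_mul_right (36 * n + 22) (Nat.succ_le_of_lt hb)
    omega
  interval_cases p <;> interval_cases q <;> interval_cases r <;> try omega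
  -- With numerical exponents, each remaining equation is linear in `n`.
  all_goals interval_cases a <;> interval_cases b <;> omega

end DigraphModel

/-! ### Vanishing below the degrees of generators, and rigidity -/

namespace DigraphModel

open CDGA CDGA.FreeGC

section

variable {V : Type u} (n : ℕ) (G : Digraph V)

/-- The generators other than `z` and the `z_(v,w)`. -/
def IsLow : Gen G → Prop
  | .z => False
  | .edge _ _ _ => False
  | _ => True

variable {n G}

/-- `ℳ_n(G)` is zero in degree `|x| - 1` for `x` one of the `x_i`, the `y_i` and the `x_v`. -/
theorem eq_zero_of_mem_grade {W : Type v} {G' : Digraph W} (hn : 1 ≤ n) {x : Gen G'}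
    (hx : IsLow G' x)
    {k : ℕ} (hk : k + 1 = deg n G' x) {b : FreeGC (deg n G)} (hb : b ∈ grade (deg n G) k) :
    b = 0 := by
  refine eq_zero_of_mono (deg n G) LinearMap.id (fun l hl => ?_) hb
  obtain h | ⟨a, b, p, q, r, c, e, hp, hq, hr, h, -⟩ := mono_cases n G l
  · exact h
  · rw [hl] at h
    cases x with
    | z => exact hx.elim
    | edge => exact hx.elim
    | vert v =>
      simp only [deg] at hk
      exact (exponents_vert hp hq hr (by rw [← h]; omega)).elim
    | _ =>
      simp only [deg] at hk
      exact (exponents_small (k := k) hn hp hq hr (by omega) h.symm).elim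

/-- The differential of `ℳ_n(G)` vanishes in degree `|x| - 1` for every generator `x`. -/
theorem diff_eq_zero_of_mem_grade {W : Type v} {G' : Digraph W} (hn : 1 ≤ n) {x : Gen G'} {k : ℕ}
    (hk : k + 1 = deg n G' x) {b : FreeGC (deg n G)} (hb : b ∈ grade (deg n G) k) :
    diff n G b = 0 := by
  by_cases hx : IsLow G' x
  · rw [eq_zero_of_mem_grade hn hx hk hb, map_zero]
  -- For `z` and `z_(v,w)` the degree below can contain nonzero elements, but only polynomials in
  -- the closed `x_i` and `x_v`.
  · have hk' : k = 540 * n ^ 2 + 654 * n + 196 := by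
      cases x <;> simp [IsLow] at hx <;> simpa [deg] using hk
    refine eq_zero_of_mono (deg n G) (diff n G) (fun l hl => ?_) hb
    obtain h | ⟨a, b, p, q, r, c, e, hp, hq, hr, h, h'⟩ := mono_cases n G l
    · rw [h, map_zero]
    · rw [hl, hk'] at h
      obtain ⟨h1, h2, h3, h4⟩ := exponents_edge hp hq hr h.symm
      exact h' h1 h2 h3 h4

/-- The differentials of the generators lie in any subalgebra that contains the `x_i`, the `y_i`
and the `x_v`. -/
theorem dGen_mem_subalgebra {S : Subalgebra ℚ (FreeGC (deg n G))}
    (hS : ∀ x, IsLow G x → g n G x ∈ S) (x : Gen G) : dGen n G x ∈ S := by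
  have h₁ := hS .x₁ trivial
  have h₂ := hS .x₂ trivial
  have k₁ := hS .y₁ trivial
  have k₂ := hS .y₂ trivial
  have k₃ := hS .y₃ trivial
  cases x with
  | x₁ => exact zero_mem _
  | x₂ => exact zero_mem _
  | vert v => exact zero_mem _
  | y₁ => exact mul_mem (pow_mem h₁ _) h₂
  | y₂ => exact mul_mem (pow_mem h₁ _) (pow_mem h₂ _)
  | y₃ => exact mul_mem h₁ (pow_mem h₂ _)
  | edge v w h =>
    have hv := hS (.vert v) trivial
    have hw := hS (.vert w) trivial
    exact add_mem (add_mem (pow_mem hv _) (mul_mem (mul_mem hv hw) (pow_mem h₂ _))) (pow_mem h₁ _)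
  | z =>
    exact add_mem (add_mem (mul_mem (pow_mem h₁ _) (add_mem (sub_mem
      (mul_mem (mul_mem (pow_mem h₂ _) k₁) k₂)
      (mul_mem (mul_mem (mul_mem h₁ h₂) k₁) k₃)) (mul_mem (mul_mem (pow_mem h₁ _) k₂) k₃)))
      (pow_mem h₁ _)) (pow_mem h₂ _)

theorem deg_pos (x : Gen G) : 0 < deg n G x := by
  cases x <;> simp [deg]

end

/-- Homotopic morphisms between the algebras `ℳ_n(G)` are equal. -/
theorem eq_of_homotopic {V₁ : Type u} {V₂ : Type v} {G₁ : Digraph V₁} {G₂ : Digraph V₂} {n : ℕ}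
    (hn : 1 ≤ n) {φ ψ : Hom (G₁.model n) (G₂.model n)} (h : Homotopic φ ψ) : φ = ψ := by
  obtain ⟨Φ, h₀, h₁⟩ := h
  -- The carrier of the model is unfolded to `FreeGC`, so that generators and subalgebras of it can
  -- be used directly.
  let Θ : FreeGC (deg n G₁) →ₐ[ℚ] TensorCarrier (G₂.model n) interval := Φ.homotopyMap
  have hlow (x : Gen G₁) (hx : IsLow G₁ x) :
      g n G₁ x ∈ (G₂.model n).polySubalgebra.comap Θ := by
    obtain ⟨k, hk⟩ := Nat.exists_eq_succ_of_ne_zero (deg_pos (n := n) x).ne'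
    have hm : g n G₁ x ∈ grade (deg n G₁) (k + 1) :=
      mem_of_eq n G₁ (gen_mem (deg n G₁) x) hk
    exact mem_polySubalgebra _ (fun b hb => eq_zero_of_mem_grade hn hx hk.symm hb)
      (Φ.homotopyMap_mem hm)
  -- Morphisms are determined on generators, and Stokes' formula now treats all generators alike.
  refine Hom.ext_toAlgHom (FreeGC.hom_ext (deg n G₁) fun x => ?_)
  obtain ⟨k, hk⟩ := Nat.exists_eq_succ_of_ne_zero (deg_pos (n := n) x).ne'
  have hm : g n G₁ x ∈ grade (deg n G₁) (k + 1) :=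
      mem_of_eq n G₁ (gen_mem (deg n G₁) x) hk
  have hd : Θ (diff n G₁ (g n G₁ x)) ∈ (G₂.model n).polySubalgebra := by
    rw [diff_g]
    exact dGen_mem_subalgebra hlow x
  exact Hom.apply_eq_of_homotopy h₀ h₁ hm
    (fun b hb => diff_eq_zero_of_mem_grade hn hk.symm hb) hd

end DigraphModel

end

theorem mainTheorem6 {V₁ : Type u} {V₂ : Type v} [Nontrivial V₁] [Nontrivial V₂]
    (G₁ : Digraph V₁) (G₂ : Digraph V₂)
    (hG₁ : G₁.StronglyConnected) (hG₂ : G₂.StronglyConnected) (n : ℕ) (hn : 1 ≤ n) :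
    (∀ f g : CDGA.Hom (G₁.model n) (G₂.model n), CDGA.Homotopic f g ↔ f = g) ∧
    Function.Bijective
      (CDGA.homotopyClass : CDGA.Hom (G₁.model n) (G₂.model n) →
        CDGA.HomotopyClasses (G₁.model n) (G₂.model n)) := by
  refine ⟨fun f g => ⟨DigraphModel.eq_of_homotopic hn, ?_⟩,
    CDGA.homotopyClass_bijective fun f g => DigraphModel.eq_of_homotopic hn⟩
  rintro rfl
  exact CDGA.Homotopic.refl f
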